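/- **Setting.** Write $[d]=\{1,\dots,d\}$, $\|\cdot\|$ for the Euclidean norm on $\mathbb R^n$, $\mathcal A(x)=\{j\in[n]:x_j=0\}$, and $\mathcal I(t)=1$ if $t\ne0$, $\mathcal I(0)=0$. Let $\Omega=\{x\in\mathbb R^n: l_j\le x_j\le u_j\ \forall j\}$ with $-l,u\in[0,\infty]^n$ and $l_j<u_j$ for all $j$; let $G_1,\dots,G_L\subseteq[n]$ (possibly overlapping) satisfy $\bigcup_l G_l=[n]$, let $x_{(l)}$ be the restriction of $x$ to $G_l$, and let $\lambda_1>0$, $\lambda_2\ge0$, $w_l\ge0$, $p\in\{1,2\}$, $\nu>0$. Consider $$(1)\quad \min_{x\in\Omega} F_0(x)=f(x)+\lambda_1\sum_{j=1}^n\mathcal I(x_j)+\lambda_2\sum_{l=1}^L w_l\,\mathcal I(\|x_{(l)}\|_p),$$ and put, for $\mu>0$ and $t\in\mathbb R$, $\theta_1(t;\mu)=0$, $\theta_2(t;\mu)=t/\mu-1$, $\theta_3(t;\mu)=-t/\mu-1$, $\theta_i(t)=\theta_i(t;\nu)$, and $\bar f(x)=f(x)+\frac{\lambda_1}{\nu}\|x\|_1+\frac{\lambda_2}{\nu}\sum_l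 w_l\|x_{(l)}\|_p$. The capped-$\ell_1$ relaxation of (1) is $$(2)\quad \min_{x\in\Omega} F(x)=\bar f(x)-\lambda_1\sum_{j=1}^n\max_{i=1,2,3}\theta_i(x_j)-\lambda_2\sum_{l=1}^L w_l\max_{i=1,2}\theta_i(\|x_{(l)}\|_p).$$ **Assumptions.** $f=f_n+f_s$ with $f_n,f_s:\mathbb R^n\to\mathbb R$ convex, $f_s$ differentiable, and $\nabla f_s$ Lipschitz continuous on $\mathbb R^n$ with constant $L_s>0$. On $\Omega$, $f$ is globally Lipschitz continuous and level-bounded (the sets $\{x\in\Omega:f(x)\le c\}$, $c\in\mathbb R$, are bounded). The constant $L_f$ satisfies $|\xi_j|\le L_f$ for all $j\in[n]$ whenever $\xi\in\partial f(x)$ with $x\in\Omega$, or $\xi\in\partial f_n(x)+\partial f_s(y)$ with $x,y\in\Omega$. Finally $\nu<\min\{\lambda_1/L_f,\vartheta\}$, where $\lambda_1/0=\infty$ and $\vartheta$ is the smallest of the numbers $|l_i|$ with $l_i\neq0$ and $u_j$ with $u_j\ne0$. **Notions.** For $x\in\mathbb R^n$, $I^x\in\{1,2,3\}^n$ and $J^x\in\{1,2\}^L$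 are given by $I^x_j=\max\operatorname{Arg\,max}_{i\in\{1,2,3\}}\theta_i(x_j)$ and $J^x_l=\max\operatorname{Arg\,max}_{i\in\{1,2\}}\theta_i(\|x_{(l)}\|_p)$. A point $x\in\Omega$ is *sw-d-stationary for (2)* if $$\lambda_1\sum_{j=1}^n\nabla\theta_{I^x_j}(x_j)+\lambda_2\sum_{l=1}^L w_l\,\partial\theta_{J^x_l}(\|x_{(l)}\|_p)\subseteq\partial\bar f(x)+N_\Omega(x),$$ where $\nabla$ and $\partial$ (the convex subdifferential) are taken with respect to the variable in $\mathbb R^n$ with $I^x,J^x$ kept fixed, and $N_\Omega$ is the normal cone. A point $x\in\Omega$ is a *$\nu$-strong local minimizer of (1)* if it is a local minimizer of $F_0$ on $\Omega$ and $|x_j|\ge\nu$ whenever $x_j\ne0$. **Algorithm 2 (DC algorithm with extrapolation).** Let $K\in\mathbb N$ and let $\{\bar\mu_k\}$ be a decreasing sequence with $\bar\mu_{K-1}\ge\nu\ge\bar\mu_K$ (the first inequality is void if $K=0$); put $\mu_k=\bar\mu_k$ for $k<K$ and $\mu_k=\nu$ for $k\ge K$. Let $x^0\in\Omega$, let $x^{-1}\in\mathbb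 R^n$ be arbitrary (for instance $x^{-1}=x^0$), and let $\beta\in[0,1)$. For $k=0,1,2,\dots$, with $I^k=I^{x^k}$ and $J^k=J^{x^k}$: choose any $\beta_k\in[0,\beta]$, set $y^k=x^k+\beta_k(x^k-x^{k-1})$, take any $\xi^k\in\partial_x\Theta_{I^k,J^k}(x^k;\mu_k)$, and set $$x^{k+1}=\operatorname*{arg\,min}_{x\in\Omega}\Big\{w_{I^k,J^k,\xi^k}(x;\mu_k,y^k,x^k)+\frac{L_s}{2}\|x-y^k\|^2\Big\},$$ where $\Theta_{I,J}(x;\mu)=\lambda_1\sum_j\theta_{I_j}(x_j;\mu)+\lambda_2\sum_l w_l\,\theta_{J_l}(\|x_{(l)}\|_p;\mu)$ and $$w_{I,J,\xi}(x;\mu,y,z)=f_n(x)+\frac{\lambda_1}{\mu}\|x\|_1+\frac{\lambda_2}{\mu}\sum_l w_l\|x_{(l)}\|_p+f_s(y)+\langle\nabla f_s(y),x-y\rangle-\Theta_{I,J}(z;\mu)-\langle\xi,x-z\rangle .$$ **Theorem 3.2.** Let $\{x^k\}$ be generated by Algorithm 2. Then: (i) $I^k$ and $J^k$ change only a finite number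 of times; $\mathcal A(x^*)=\mathcal A(\hat x)$ for any accumulation points $x^*$, $\hat x$ of $\{x^k\}$; and for any accumulation point $x^*$ there is $k_0$ such that $x^k_j=0$ for all $k\ge k_0$ and $j\in\mathcal A(x^*)$. (ii) Any accumulation point of $\{x^k\}$ is an sw-d-stationary point of (2) and also a $\nu$-strong local minimizer of (1). -/

import Mathlib

open Set Filter Topology
open scoped Pointwise Gradient ENNReal InnerProductSpace

noncomputable section

namespace SparseGroup

/-- `ℝⁿ` with its Euclidean norm and inner product. -/
abbrev E (n : ℕ) := EuclideanSpace ℝ (Fin n)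

/-- The subdifferential (in the sense of convex analysis) of a real-valued function at `x`. -/
def subdiff {n : ℕ} (h : E n → ℝ) (x : E n) : Set (E n) :=
  {ξ | ∀ y, h x + ⟪ξ, y - x⟫_ℝ ≤ h y}

/-- The normal cone (in the sense of convex analysis) of `S` at `x`. -/
def normalCone {n : ℕ} (S : Set (E n)) (x : E n) : Set (E n) :=
  {v | ∀ y ∈ S, ⟪v, y - x⟫_ℝ ≤ 0}

/-- The zero set `𝒜(x) = {j : x_j = 0}`. -/
def zeroSet {n : ℕ} (x : E n) : Set (Fin n) := {j | x j = 0}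

/-- The indicator of being nonzero: `1` if `t ≠ 0`, and `0` if `t = 0`. -/
def nz (t : ℝ) : ℝ := if t = 0 then 0 else 1

/-- `‖x_S‖_p`, the `ℓ_p` norm of the restriction of `x` to the index set `S`. -/
def groupNorm {n : ℕ} (p : ℝ≥0∞) (S : Finset (Fin n)) (x : E n) : ℝ :=
  ‖(WithLp.toLp p (fun j : S => x j) : PiLp p (fun _ : S => ℝ))‖

/-- The three affine pieces `0`, `t/μ - 1`, `-t/μ - 1`. The indices `0, 1, 2` of `Fin 3` stand for
the usual labels `1, 2, 3`, in the same order. -/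
def theta (i : Fin 3) (t μ : ℝ) : ℝ := ![0, t / μ - 1, -t / μ - 1] i

/-- The set of maximizers of `g`. -/
def argMaxSet {m : ℕ} (g : Fin m → ℝ) : Finset (Fin m) :=
  Finset.univ.filter fun i => ∀ k, g k ≤ g i

theorem argMaxSet_nonempty {m : ℕ} [NeZero m] (g : Fin m → ℝ) : (argMaxSet g).Nonempty := by
  obtain ⟨i, -, hi⟩ := Finset.exists_max_image Finset.univ g ⟨0, Finset.mem_univ 0⟩
  exact ⟨i, by simpa [argMaxSet] using hi⟩

/-- The largest index at which `g` attains its maximum. -/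
def maxArgMax {m : ℕ} [NeZero m] (g : Fin m → ℝ) : Fin m :=
  (argMaxSet g).max' (argMaxSet_nonempty g)

/-- The data of a sparse group `ℓ₀` problem on `ℝⁿ` with `L` groups and of its capped-`ℓ₁`
relaxation. -/
structure Problem (n L : ℕ) where
  /-- nonsmooth part of the loss -/
  fn : E n → ℝ
  /-- smooth part of the loss -/
  fs : E n → ℝ
  /-- weight of the entrywise sparsity -/
  lam1 : ℝ
  /-- weight of the group sparsity -/
  lam2 : ℝ
  /-- weights of the single groups -/
  w : Fin L → ℝ
  /-- the groups, possibly overlapping -/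
  G : Fin L → Finset (Fin n)
  /-- exponent of the group norms -/
  p : ℝ≥0∞
  /-- lower bounds, possibly `-∞` -/
  lo : Fin n → EReal
  /-- upper bounds, possibly `+∞` -/
  hi : Fin n → EReal
  /-- parameter of the capped-`ℓ₁` function -/
  ν : ℝ
  /-- bound for the entries of the subgradients of the loss -/
  Lf : ℝ
  /-- Lipschitz constant of the gradient of the smooth part -/
  Ls : ℝ

namespace Problem

variable {n L : ℕ} (P : Problem n L)

/-- The loss function `f = f_n + f_s`. -/
def f (x : E n) : ℝ := P.fn x + P.fs x

/-- The box `Ω = [l, u]`. -/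
def Ω : Set (E n) := {x | ∀ j, P.lo j ≤ (x j : EReal) ∧ (x j : EReal) ≤ P.hi j}

/-- `ϑ`, the smallest of the numbers `|l_i|` with `l_i ≠ 0` and `u_j` with `u_j ≠ 0`
(here `l ≤ 0`, so `|l_i| = -l_i`). -/
def vartheta : EReal :=
  sInf ({t | ∃ i, P.lo i ≠ 0 ∧ t = -P.lo i} ∪ {t | ∃ j, P.hi j ≠ 0 ∧ t = P.hi j})

/-- The sparse group `ℓ₀` objective
`F₀(x) = f(x) + λ₁ ‖x‖₀ + λ₂ ∑ w_l 𝓘(‖x_(l)‖_p)`. -/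
def F0 (x : E n) : ℝ :=
  P.f x + P.lam1 * ∑ j, nz (x j) + P.lam2 * ∑ l, P.w l * nz (groupNorm P.p (P.G l) x)

/-- `f̄(x) = f(x) + (λ₁/ν) ‖x‖₁ + (λ₂/ν) ∑ w_l ‖x_(l)‖_p`. -/
def fbar (x : E n) : ℝ :=
  P.f x + P.lam1 / P.ν * ∑ j, |x j| + P.lam2 / P.ν * ∑ l, P.w l * groupNorm P.p (P.G l) x

/-- `f̄_n(x; μ) = f_n(x) + (λ₁/μ) ‖x‖₁ + (λ₂/μ) ∑ w_l ‖x_(l)‖_p`. -/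
def fnbar (x : E n) (μ : ℝ) : ℝ :=
  P.fn x + P.lam1 / μ * ∑ j, |x j| + P.lam2 / μ * ∑ l, P.w l * groupNorm P.p (P.G l) x

/-- `I^x`: entrywise the largest index that attains `max_{i=1,2,3} θ_i(x_j)`, with parameter `ν`. -/
def idxI (x : E n) : Fin n → Fin 3 := fun j => maxArgMax fun i => theta i (x j) P.ν

/-- `J^x`: groupwise the largest index that attains `max_{i=1,2} θ_i(‖x_(l)‖_p)`, with
parameter `ν`. -/
def idxJ (x : E n) : Fin L → Fin 2 :=
  fun l => maxArgMax fun i : Fin 2 => theta i.castSucc (groupNorm P.p (P.G l) x) P.ν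

/-- `Θ_{I,J}(x; μ) = λ₁ ∑ θ_{I_j}(x_j; μ) + λ₂ ∑ w_l θ_{J_l}(‖x_(l)‖_p; μ)`. -/
def Theta (I : Fin n → Fin 3) (J : Fin L → Fin 2) (x : E n) (μ : ℝ) : ℝ :=
  P.lam1 * ∑ j, theta (I j) (x j) μ +
    P.lam2 * ∑ l, P.w l * theta (J l).castSucc (groupNorm P.p (P.G l) x) μ

/-- `w_{I,J,ξ}(x; μ, y, z)`, the convex model that is minimized in each iteration. -/
def model (I : Fin n → Fin 3) (J : Fin L → Fin 2) (ξ x : E n) (μ : ℝ) (y z : E n) : ℝ :=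
  P.fnbar x μ + P.fs y + ⟪∇ P.fs y, x - y⟫_ℝ - P.Theta I J z μ - ⟪ξ, x - z⟫_ℝ

/-- `x` is an sw-d-stationary point of the capped-`ℓ₁` relaxation: `x ∈ Ω` and
`λ₁ ∑ ∇θ_{I^x_j}(x_j) + λ₂ ∑ w_l ∂θ_{J^x_l}(‖x_(l)‖_p) ⊆ ∂f̄(x) + N_Ω(x)`, where gradients and
subdifferentials are with respect to the variable in `ℝⁿ`, and the index vectors are kept fixed at
`I^x` and `J^x`. -/
def IsSwdStationary (x : E n) : Prop :=
  x ∈ P.Ω ∧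
    ({P.lam1 • ∑ j, ∇ (fun z : E n => theta (P.idxI x j) (z j) P.ν) x} : Set (E n)) +
        P.lam2 • ∑ l, P.w l •
          subdiff (fun z : E n => theta (P.idxJ x l).castSucc (groupNorm P.p (P.G l) z) P.ν) x
      ⊆ subdiff P.fbar x + normalCone P.Ω x

/-- `x` is a `ν`-strong local minimizer of `F₀` over `Ω`: a local minimizer all of whose nonzero
entries have absolute value at least `ν`. -/
def IsStrongLocalMin (x : E n) : Prop :=
  x ∈ P.Ω ∧ IsLocalMinOn P.F0 P.Ω x ∧ ∀ j, x j ≠ 0 → P.ν ≤ |x j|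

/-- The standing assumptions on the problem data. -/
structure Assumptions : Prop where
  lam1_pos : 0 < P.lam1
  lam2_nonneg : 0 ≤ P.lam2
  w_nonneg : ∀ l, 0 ≤ P.w l
  p_eq : P.p = 1 ∨ P.p = 2
  cover : ∀ j, ∃ l, j ∈ P.G l
  lo_nonpos : ∀ j, P.lo j ≤ 0
  hi_nonneg : ∀ j, 0 ≤ P.hi j
  lo_lt_hi : ∀ j, P.lo j < P.hi j
  convex_fn : ConvexOn ℝ univ P.fn
  convex_fs : ConvexOn ℝ univ P.fs
  differentiable_fs : Differentiable ℝ P.fs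
  Ls_pos : 0 < P.Ls
  lipschitz_grad : ∀ x y, ‖∇ P.fs x - ∇ P.fs y‖ ≤ P.Ls * ‖x - y‖
  /-- `f` is globally Lipschitz continuous on `Ω` -/
  lipschitz_f : ∃ C, LipschitzOnWith C P.f P.Ω
  /-- `f` is level-bounded on `Ω` -/
  level_bounded : ∀ c : ℝ, Bornology.IsBounded {x ∈ P.Ω | P.f x ≤ c}
  /-- `L_f ≥ sup {|ξ_j| : ξ ∈ ∂f(x), x ∈ Ω}` -/
  Lf_bound : ∀ x ∈ P.Ω, ∀ ξ ∈ subdiff P.f x, ∀ j, |ξ j| ≤ P.Lf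
  /-- `L_f ≥ sup {|ξ_j| : ξ ∈ ∂f_n(x) + ∂f_s(y), x, y ∈ Ω}` -/
  Lf_bound_split : ∀ x ∈ P.Ω, ∀ y ∈ P.Ω, ∀ ξ ∈ subdiff P.fn x + subdiff P.fs y, ∀ j, |ξ j| ≤ P.Lf
  ν_pos : 0 < P.ν
  /-- `ν < λ₁ / L_f`, where `λ₁ / 0 = ∞` -/
  ν_lt : P.ν * P.Lf < P.lam1
  ν_lt_vartheta : (P.ν : EReal) < P.vartheta

/-- `μ` is an admissible parameter sequence: for some `K` and some decreasing sequence `μ̄` with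
`μ̄_{K-1} ≥ ν ≥ μ̄_K` one has `μ_k = μ̄_k` for `k < K` and `μ_k = ν` for `k ≥ K`. (For `K = 0` there
is no `μ̄_{K-1}`, and `μ` is constant.) -/
def IsSchedule (μ : ℕ → ℝ) : Prop :=
  ∃ (K : ℕ) (μbar : ℕ → ℝ), Antitone μbar ∧ (0 < K → P.ν ≤ μbar (K - 1)) ∧ μbar K ≤ P.ν ∧
    ∀ k, μ k = if k < K then μbar k else P.ν

/-- The predecessor `x^{k-1}` of `x^k`, where `x^{-1} = xprev`. -/
def pred (xprev : E n) (x : ℕ → E n) : ℕ → E n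
  | 0 => xprev
  | k + 1 => x k

/-- The extrapolated points `y^k = x^k + β_k (x^k - x^{k-1})`. -/
def extrap (xprev : E n) (x : ℕ → E n) (b : ℕ → ℝ) (k : ℕ) : E n :=
  x k + b k • (x k - pred xprev x k)

/-- `x` is a sequence of iterates of the DC algorithm with extrapolation, with parameters `μ_k`,
bound `β`, extrapolation weights `b k = β_k`, subgradients `ξ k`, and `x^{-1} = xprev`. The choice
of `xprev` is free; `xprev = x 0` is the usual convention. -/
structure IsRun (μ : ℕ → ℝ) (β : ℝ) (b : ℕ → ℝ) (xprev : E n) (ξ x : ℕ → E n) : Prop where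
  schedule : P.IsSchedule μ
  β_mem : β ∈ Ico (0 : ℝ) 1
  init : x 0 ∈ P.Ω
  b_mem : ∀ k, b k ∈ Icc 0 β
  subgrad : ∀ k, ξ k ∈ subdiff (fun z => P.Theta (P.idxI (x k)) (P.idxJ (x k)) z (μ k)) (x k)
  mem : ∀ k, x (k + 1) ∈ P.Ω
  /-- `x^{k+1}` minimizes the model plus the proximal term over `Ω` -/
  argmin : ∀ k, IsMinOn
    (fun z => P.model (P.idxI (x k)) (P.idxJ (x k)) (ξ k) z (μ k) (extrap xprev x b k) (x k) +
      P.Ls / 2 * ‖z - extrap xprev x b k‖ ^ 2) P.Ω (x (k + 1))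

end Problem

end SparseGroup

end

namespace SparseGroup

/-! Once the parameter has reached `ν`, every iteration is a proximal step on a convex model.
Convexity and the descent lemma give `capped x' + Ls/2 ‖x' - x‖² ≤ capped x + Ls/2 ‖x - y‖²`. Since
`‖x - y‖` is at most `β < 1` times the previous step length, `capped` plus `Ls/2` times the squared
step length is an energy that decreases and is bounded below. Hence step lengths tend to zero
(`IsRun.tendsto_norm_sub`).

The decisive point is `IsStep.apply_eq_zero`: if `|x_j| < ν` and the step is short, then `x'_j = 0`.
At such an entry the subtracted piece is constant, so shrinking `x'_j` gains the slope `λ₁/ν`, while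
the loss costs at most `L_f < λ₁/ν` up to small errors. The group terms nearly cancel: what the
subgradient `ξ` subtracts at `x` is almost what the group norms add at `x'`. So an entry that ever
falls below `ν` late in the run stays zero, and the other entries cannot change sign because steps
are shorter than `ν`. The pattern of zeros and signs is therefore eventually constant. Being closed,
it passes to accumulation points, which gives part (i) and the gap `|a_j| ≥ ν` on the support.

For part (ii), the step inequality passes to the limit with the indices frozen. Along directions
within the support of a limit `a`, the convex penalties and the subtracted pieces cancel to first
order, so `a` minimizes `f` over the points of `Ω` that vanish where `a` does (`f_le_of_fnbar_le`).
Both conclusions follow from this and the gap: a new nonzero entry costs at least `λ₁`, and off the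
support a subgradient of `f` is absorbed by `(λ₁/ν) ‖·‖₁`. -/

/-- Divide by `t` and let `t` tend to zero. This turns every perturbation argument below into a
first-order inequality. If `A < 0`, the explicit `t` chosen in the proof satisfies `t * |B| < -A /
2`, a contradiction. -/
theorem nonneg_of_forall_mul_add_sq_mul {A B : ℝ}
    (h : ∀ t : ℝ, 0 < t → t ≤ 1 → 0 ≤ t * A + t ^ 2 * B) : 0 ≤ A := by
  by_contra! hA
  have hB : 0 < |B| + 1 := by positivity
  have hAB : 0 < -A + 2 * (|B| + 1) := by linarith
  have ht : 0 < -A / (-A + 2 * (|B| + 1)) := div_pos (by linarith) hAB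
  have ht1 : -A / (-A + 2 * (|B| + 1)) ≤ 1 := by rw [div_le_one hAB]; linarith
  have h1 := h _ ht ht1
  set t := -A / (-A + 2 * (|B| + 1)) with htdef
  have h2 : t * (-A + 2 * (|B| + 1)) = -A := div_mul_cancel₀ _ hAB.ne'
  have h3 : 0 ≤ A + t * B := by
    have : 0 ≤ t * (A + t * B) := by nlinarith
    exact nonneg_of_mul_nonneg_right this ht
  have h4 : t * B ≤ t * |B| := by gcongr; exact le_abs_self B
  nlinarith [mul_pos ht (neg_pos.2 hA)]

/-! ### Convex analysis: subgradients, proximal steps, the descent lemma. -/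

section Convex

variable {n : ℕ} {g : E n → ℝ}

theorem continuous_of_convexOn_univ (hg : ConvexOn ℝ univ g) : Continuous g :=
  continuousOn_univ.1 (hg.continuousOn isOpen_univ)

/-- Optimality condition for the minimization of a convex function over a convex set. -/
theorem exists_mem_subdiff_of_isMinOn (hg : ConvexOn ℝ univ g) {C : Set (E n)}
    (hC : Convex ℝ C) {a : E n} (ha : a ∈ C) (hmin : IsMinOn g C a) :
    ∃ ζ ∈ subdiff g a, ∀ z ∈ C, 0 ≤ ⟪ζ, z - a⟫_ℝ := by
  have hgc := continuous_of_convexOn_univ hg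
  have hS : Convex ℝ {q : E n × ℝ | g q.1 < q.2} := by
    simpa using hg.convex_strict_epigraph
  have hSo : IsOpen {q : E n × ℝ | g q.1 < q.2} :=
    isOpen_lt (hgc.comp continuous_fst) continuous_snd
  have hT : Convex ℝ (C ×ˢ Iic (g a)) := hC.prod (convex_Iic _)
  have hdisj : Disjoint {q : E n × ℝ | g q.1 < q.2} (C ×ˢ Iic (g a)) := by
    rw [Set.disjoint_left]
    rintro ⟨q, t⟩ h1 ⟨h2, h3⟩
    have := hmin h2
    simp only [mem_ofPred_eq, mem_Iic] at *
    linarith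
  -- The open strict epigraph of `g` is separated from `C × (-∞, g a]`. The vertical component `s`
  -- of the functional turns out negative, and dividing the horizontal component by `-s` gives the
  -- subgradient.
  obtain ⟨F, u, h1, h2⟩ := geometric_hahn_banach_open hS hSo hT hdisj
  have hF : ∀ (q : E n) (t : ℝ), F (q, t) = F (q, 0) + t * F (0, 1) := by
    intro q t
    have : ((q, t) : E n × ℝ) = (q, 0) + t • (0, 1) := by simp
    rw [this, map_add, map_smul, smul_eq_mul]
  set s := F (0, 1) with hs
  have hS' : ∀ q t, g q < t → F (q, 0) + t * s < u := fun q t hq => by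
    rw [← hF]; exact h1 _ hq
  have hT' : ∀ q ∈ C, u ≤ F (q, 0) + g a * s := fun q hq => by
    rw [← hF]; exact h2 _ ⟨hq, mem_Iic.2 le_rfl⟩
  have hsneg : s < 0 := by
    have e1 := hS' a (g a + 1) (by linarith)
    have e2 := hT' a ha
    nlinarith
  have hS'' : ∀ q, F (q, 0) + g q * s ≤ u := by
    intro q
    refine le_of_forall_pos_le_add fun ε hε => ?_
    have := hS' q (g q + ε / (-s)) (by have := div_pos hε (neg_pos.2 hsneg); linarith)
    have h3 : ε / (-s) * s = -ε := by
      rw [div_neg, neg_mul, div_mul_cancel₀ _ hsneg.ne]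
    nlinarith
  have hu : u = F (a, 0) + g a * s := le_antisymm (hT' a ha) (hS'' a)
  let φ : E n →L[ℝ] ℝ := F.comp (ContinuousLinearMap.inl ℝ (E n) ℝ)
  have hφ : ∀ q, φ q = F (q, 0) := fun q => rfl
  let η : E n := (InnerProductSpace.toDual ℝ (E n)).symm φ
  have hη : ∀ q, ⟪η, q⟫_ℝ = F (q, 0) := fun q => by
    rw [← hφ]; exact InnerProductSpace.toDual_symm_apply
  refine ⟨(-s)⁻¹ • η, fun y => ?_, fun z hz => ?_⟩
  · rw [real_inner_smul_left, inner_sub_right, hη, hη]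
    have h3 := hS'' y
    have h4 : (-s)⁻¹ * (F (y, 0) - F (a, 0)) ≤ g y - g a := by
      rw [inv_mul_le_iff₀ (neg_pos.2 hsneg)]
      nlinarith
    linarith
  · rw [real_inner_smul_left, inner_sub_right, hη, hη]
    have h3 := hT' z hz
    exact mul_nonneg (inv_nonneg.2 (by linarith)) (by linarith)

/-- This is the optimality condition on the one-point set `{a}`, where minimality is trivial. -/
theorem subdiff_nonempty (hg : ConvexOn ℝ univ g) (a : E n) : (subdiff g a).Nonempty := by
  obtain ⟨ζ, hζ, -⟩ := exists_mem_subdiff_of_isMinOn hg (convex_singleton a) (mem_singleton a)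
    (fun z hz => by rw [mem_singleton_iff.1 hz]; exact le_refl (g a))
  exact ⟨ζ, hζ⟩

/-- Variational inequality for a proximal step. -/
theorem le_add_inner_of_isMinOn_prox (hg : ConvexOn ℝ univ g) {C : Set (E n)}
    (hC : Convex ℝ C) {c : ℝ} {a y : E n} (ha : a ∈ C)
    (hmin : IsMinOn (fun z => g z + c / 2 * ‖z - y‖ ^ 2) C a) {z : E n} (hz : z ∈ C) :
    g a ≤ g z + c * ⟪a - y, z - a⟫_ℝ := by
  suffices h : 0 ≤ g z - g a + c * ⟪a - y, z - a⟫_ℝ by linarith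
  refine nonneg_of_forall_mul_add_sq_mul (B := c / 2 * ‖z - a‖ ^ 2) fun t ht ht1 => ?_
  have hw : a + t • (z - a) = (1 - t) • a + t • z := by module
  have hwC : a + t • (z - a) ∈ C := by
    rw [hw]; exact hC ha hz (by linarith) ht.le (by ring)
  have h1 : g (a + t • (z - a)) ≤ (1 - t) * g a + t * g z := by
    rw [hw]; exact hg.2 (mem_univ _) (mem_univ _) (by linarith) ht.le (by ring)
  have h2 : g a + c / 2 * ‖a - y‖ ^ 2
      ≤ g (a + t • (z - a)) + c / 2 * ‖a + t • (z - a) - y‖ ^ 2 := hmin hwC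
  have h3 : ‖a + t • (z - a) - y‖ ^ 2
      = ‖a - y‖ ^ 2 + 2 * t * ⟪a - y, z - a⟫_ℝ + t ^ 2 * ‖z - a‖ ^ 2 := by
    rw [show a + t • (z - a) - y = (a - y) + t • (z - a) by abel, norm_add_sq_real,
      real_inner_smul_right, norm_smul, mul_pow, Real.norm_eq_abs, sq_abs]
    ring
  rw [h3] at h2
  linarith

theorem hasDerivAt_comp_line (hd : Differentiable ℝ g) (a d : E n) (t : ℝ) :
    HasDerivAt (fun s : ℝ => g (a + s • d)) ⟪∇ g (a + t • d), d⟫_ℝ t := by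
  have h1 : HasDerivAt (fun s : ℝ => a + s • d) d t := by
    simpa using ((hasDerivAt_id t).smul_const d).const_add a
  have h2 := ((hd (a + t • d)).hasGradientAt.hasFDerivAt).comp_hasDerivAt t h1
  rw [InnerProductSpace.toDual_apply_apply] at h2
  exact h2

theorem gradient_mem_subdiff (hg : ConvexOn ℝ univ g) (hd : Differentiable ℝ g) (a : E n) :
    ∇ g a ∈ subdiff g a := by
  intro y
  have h1 := hasDerivAt_comp_line hd a (y - a) 0
  have hc : ConvexOn ℝ univ (fun s : ℝ => g (a + s • (y - a))) := by
    refine ⟨convex_univ, fun s _ t _ p q hp hq hpq => ?_⟩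
    have : a + (p • s + q • t) • (y - a) = p • (a + s • (y - a)) + q • (a + t • (y - a)) := by
      have : a = p • a + q • a := by rw [← add_smul, hpq, one_smul]
      nth_rewrite 1 [this]
      simp only [smul_eq_mul]
      module
    simp only [this]
    exact hg.2 (mem_univ _) (mem_univ _) hp hq hpq
  have h2 := hc.le_slope_of_hasDerivAt (mem_univ 0) (mem_univ 1) one_pos h1
  simp only [slope_def_field, zero_smul, one_smul, add_zero, sub_zero, div_one,
    add_sub_cancel] at h2
  linarith

/-- Descent lemma for functions with Lipschitz gradient. -/
theorem le_add_inner_add_sq_of_lipschitz_gradient (hd : Differentiable ℝ g) {K : ℝ}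
    (hK : ∀ a b, ‖∇ g a - ∇ g b‖ ≤ K * ‖a - b‖) (a y : E n) :
    g a ≤ g y + ⟪∇ g y, a - y⟫_ℝ + K / 2 * ‖a - y‖ ^ 2 := by
  set d := a - y with hd'
  have hder : ∀ t : ℝ, HasDerivAt
      (fun s : ℝ => g (y + s • d) - (s * ⟪∇ g y, d⟫_ℝ + s ^ 2 * (K / 2 * ‖d‖ ^ 2)))
      (⟪∇ g (y + t • d), d⟫_ℝ - (⟪∇ g y, d⟫_ℝ + t * (K * ‖d‖ ^ 2))) t := by
    intro t
    refine (hasDerivAt_comp_line hd y d t).sub ?_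
    have h1 := (hasDerivAt_id t).mul_const ⟪∇ g y, d⟫_ℝ
    have h2 := ((hasDerivAt_id t).pow 2).mul_const (K / 2 * ‖d‖ ^ 2)
    refine (h1.add h2).congr_deriv ?_
    simp only [id]
    push_cast
    ring
  -- Along the segment from `y` to `a`, subtract the quadratic upper model; the Lipschitz bound
  -- makes the derivative of the difference nonpositive.
  have hanti : AntitoneOn
      (fun s : ℝ => g (y + s • d) - (s * ⟪∇ g y, d⟫_ℝ + s ^ 2 * (K / 2 * ‖d‖ ^ 2))) (Icc 0 1) := by
    refine antitoneOn_of_deriv_nonpos (convex_Icc 0 1)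
      (fun t _ => (hder t).continuousAt.continuousWithinAt)
      (fun t _ => (hder t).differentiableAt.differentiableWithinAt) fun t ht => ?_
    rw [interior_Icc] at ht
    rw [(hder t).deriv]
    have h1 : ⟪∇ g (y + t • d) - ∇ g y, d⟫_ℝ ≤ K * (t * ‖d‖) * ‖d‖ := by
      refine (real_inner_le_norm _ _).trans ?_
      gcongr
      refine (hK _ _).trans_eq ?_
      rw [add_sub_cancel_left, norm_smul, Real.norm_of_nonneg ht.1.le]
    rw [inner_sub_left] at h1
    nlinarith
  have := hanti (left_mem_Icc.2 zero_le_one) (right_mem_Icc.2 zero_le_one) zero_le_one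
  simp only [one_smul, zero_smul, add_zero] at this
  rw [show y + d = a by simp [hd']] at this
  linarith

end Convex

/-! ### Group norms and their first- and second-order expansions. -/

section GroupNorm

variable {n : ℕ} {p : ℝ≥0∞} {S : Finset (Fin n)}

theorem groupNorm_one (S : Finset (Fin n)) (x : E n) : groupNorm 1 S x = ∑ j ∈ S, |x j| := by
  rw [groupNorm, PiLp.norm_eq_of_L1]
  simp only [Real.norm_eq_abs]
  exact Finset.sum_coe_sort S fun j => |x j|

theorem groupNorm_two (S : Finset (Fin n)) (x : E n) :
    groupNorm 2 S x = √(∑ j ∈ S, x j ^ 2) := by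
  rw [groupNorm, PiLp.norm_eq_of_L2]
  simp only [Real.norm_eq_abs, sq_abs]
  rw [Finset.sum_coe_sort S fun j => x j ^ 2]

theorem sq_groupNorm_two (S : Finset (Fin n)) (x : E n) :
    groupNorm 2 S x ^ 2 = ∑ j ∈ S, x j ^ 2 := by
  rw [groupNorm_two, Real.sq_sqrt (Finset.sum_nonneg fun j _ => sq_nonneg _)]

theorem groupNorm_nonneg (hp : p = 1 ∨ p = 2) (S : Finset (Fin n)) (x : E n) :
    0 ≤ groupNorm p S x := by
  rcases hp with rfl | rfl
  · rw [groupNorm_one]; positivity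
  · rw [groupNorm_two]; positivity

theorem abs_le_groupNorm (hp : p = 1 ∨ p = 2) {j : Fin n} (hj : j ∈ S) (x : E n) :
    |x j| ≤ groupNorm p S x := by
  rcases hp with rfl | rfl
  · rw [groupNorm_one]
    exact Finset.single_le_sum (f := fun j => |x j|) (fun i _ => abs_nonneg _) hj
  · rw [groupNorm_two]
    refine Real.abs_le_sqrt ?_
    exact Finset.single_le_sum (f := fun j => x j ^ 2) (fun i _ => sq_nonneg _) hj

theorem groupNorm_le_of_abs_le (hp : p = 1 ∨ p = 2) {x y : E n} (h : ∀ j ∈ S, |x j| ≤ |y j|) :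
    groupNorm p S x ≤ groupNorm p S y := by
  rcases hp with rfl | rfl
  · rw [groupNorm_one, groupNorm_one]
    exact Finset.sum_le_sum h
  · rw [groupNorm_two, groupNorm_two]
    exact Real.sqrt_le_sqrt (Finset.sum_le_sum fun j hj => sq_le_sq.2 (h j hj))

theorem groupNorm_congr (hp : p = 1 ∨ p = 2) {x y : E n} (h : ∀ j ∈ S, x j = y j) :
    groupNorm p S x = groupNorm p S y :=
  le_antisymm (groupNorm_le_of_abs_le hp fun j hj => by rw [h j hj])
    (groupNorm_le_of_abs_le hp fun j hj => by rw [h j hj])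

theorem groupNorm_eq_zero (hp : p = 1 ∨ p = 2) {x : E n} (h : ∀ j ∈ S, x j = 0) :
    groupNorm p S x = 0 := by
  rw [groupNorm_congr (y := 0) hp (by simpa using h)]
  rcases hp with rfl | rfl
  · simp [groupNorm_one]
  · simp [groupNorm_two]

theorem convexOn_groupNorm (hp : p = 1 ∨ p = 2) (S : Finset (Fin n)) :
    ConvexOn ℝ univ (groupNorm p S) := by
  have : Fact (1 ≤ p) := ⟨by rcases hp with rfl | rfl <;> norm_num⟩
  refine ⟨convex_univ, fun x _ y _ s t hs ht _ => ?_⟩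
  have h : (WithLp.toLp p (fun j : S => (s • x + t • y) j) : PiLp p (fun _ : S => ℝ))
      = s • WithLp.toLp p (fun j : S => x j) + t • WithLp.toLp p (fun j : S => y j) := by
    ext j; simp
  rw [groupNorm, h]
  refine (norm_add_le _ _).trans_eq ?_
  rw [norm_smul, norm_smul, Real.norm_of_nonneg hs, Real.norm_of_nonneg ht]
  rfl

theorem abs_groupNorm_two_sub_le (S : Finset (Fin n)) (x y : E n) :
    |groupNorm 2 S x - groupNorm 2 S y| ≤ ‖x - y‖ := by
  have h := abs_norm_sub_norm_le (WithLp.toLp 2 (fun j : S => x j) : PiLp 2 (fun _ : S => ℝ))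
    (WithLp.toLp 2 (fun j : S => y j))
  have h2 : ‖(WithLp.toLp 2 (fun j : S => x j) : PiLp 2 (fun _ : S => ℝ))
      - WithLp.toLp 2 (fun j : S => y j)‖ = groupNorm 2 S (x - y) := rfl
  rw [h2] at h
  refine h.trans ?_
  rw [groupNorm_two, EuclideanSpace.norm_eq]
  refine Real.sqrt_le_sqrt ?_
  simp only [Real.norm_eq_abs, sq_abs]
  exact Finset.sum_le_sum_of_subset_of_nonneg (Finset.subset_univ S) fun j _ _ => sq_nonneg _

/-- First-order upper expansion of the Euclidean group norm. -/
theorem groupNorm_two_add_le {x : E n} (hx : 0 < groupNorm 2 S x) (h : E n) :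
    groupNorm 2 S (x + h) ≤ groupNorm 2 S x +
      (2 * ∑ j ∈ S, x j * h j + ∑ j ∈ S, h j ^ 2) / (2 * groupNorm 2 S x) := by
  set A := groupNorm 2 S x with hA
  set δ := 2 * ∑ j ∈ S, x j * h j + ∑ j ∈ S, h j ^ 2 with hδ
  have h1 : groupNorm 2 S (x + h) ^ 2 = A ^ 2 + δ := by
    rw [sq_groupNorm_two, hA, sq_groupNorm_two, hδ, Finset.mul_sum, ← Finset.sum_add_distrib,
      ← Finset.sum_add_distrib]
    refine Finset.sum_congr rfl fun j _ => ?_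
    rw [PiLp.add_apply]; ring
  have h2 : δ = 2 * A * (δ / (2 * A)) := by field_simp
  -- With `r` the new norm, `r² = A² + δ` and `2 A r ≤ A² + r²`; divide by `2 A`.
  nlinarith [sq_nonneg (groupNorm 2 S (x + h) - A)]

/-- The one-dimensional case of the preceding expansion, with the same proof by completing a square.
-/
theorem abs_add_le_of_ne_zero {a : ℝ} (ha : a ≠ 0) (h : ℝ) :
    |a + h| ≤ |a| + (2 * (a * h) + h ^ 2) / (2 * |a|) := by
  have hA : 0 < |a| := abs_pos.2 ha
  have h1 : |a + h| ^ 2 = |a| ^ 2 + (2 * (a * h) + h ^ 2) := by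
    rw [sq_abs, sq_abs]; ring
  have h2 : 2 * (a * h) + h ^ 2 = 2 * |a| * ((2 * (a * h) + h ^ 2) / (2 * |a|)) := by
    field_simp
  nlinarith [sq_nonneg (|a + h| - |a|)]

/-- Second differences of a group norm along a direction supported in the support of the base
point are of second order. -/
theorem exists_groupNorm_second_difference_le (hp : p = 1 ∨ p = 2) {a h : E n}
    (hah : ∀ j ∈ S, a j = 0 → h j = 0) :
    ∃ C : ℝ, ∀ t : ℝ,
      groupNorm p S (a + t • h) + groupNorm p S (a - t • h) ≤ 2 * groupNorm p S a + t ^ 2 * C := by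
  rcases hp with rfl | rfl
  · refine ⟨∑ j ∈ S, h j ^ 2 / |a j|, fun t => ?_⟩
    simp only [groupNorm_one]
    rw [Finset.mul_sum, Finset.mul_sum, ← Finset.sum_add_distrib, ← Finset.sum_add_distrib]
    refine Finset.sum_le_sum fun j hj => ?_
    simp only [PiLp.add_apply, PiLp.sub_apply, PiLp.smul_apply, smul_eq_mul]
    by_cases ha : a j = 0
    · simp [ha, hah j hj ha]
    · have h1 := abs_add_le_of_ne_zero ha (t * h j)
      have h2 := abs_add_le_of_ne_zero ha (-(t * h j))
      rw [← sub_eq_add_neg] at h2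
      have hA : 0 < |a j| := abs_pos.2 ha
      have h3 : (2 * (a j * (t * h j)) + (t * h j) ^ 2) / (2 * |a j|) +
          (2 * (a j * (-(t * h j))) + (-(t * h j)) ^ 2) / (2 * |a j|)
          = t ^ 2 * (h j ^ 2 / |a j|) := by
        field_simp; ring
      linarith
  · refine ⟨(∑ j ∈ S, h j ^ 2) / groupNorm 2 S a, fun t => ?_⟩
    rcases (groupNorm_nonneg (Or.inr rfl) S a).eq_or_lt with h0 | h0
    · have ha : ∀ j ∈ S, a j = 0 := fun j hj => by
        have := abs_le_groupNorm (p := 2) (Or.inr rfl) hj a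
        rw [← h0] at this
        exact abs_nonpos_iff.1 this
      rw [groupNorm_eq_zero (Or.inr rfl) (x := a + t • h), groupNorm_eq_zero (Or.inr rfl)
        (x := a - t • h), ← h0]
      · simp
      · intro j hj; simp [ha j hj, hah j hj (ha j hj)]
      · intro j hj; simp [ha j hj, hah j hj (ha j hj)]
    · have h1 := groupNorm_two_add_le h0 (t • h)
      have h2 := groupNorm_two_add_le h0 (-(t • h))
      rw [← sub_eq_add_neg] at h2
      simp only [PiLp.neg_apply, PiLp.smul_apply, smul_eq_mul, mul_neg, Finset.sum_neg_distrib,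
        neg_sq, mul_pow, ← Finset.mul_sum] at h1 h2
      generalize ∑ j ∈ S, a j * (t * h j) = Q at h1 h2
      have h3 : (2 * Q + t ^ 2 * ∑ j ∈ S, h j ^ 2)
            / (2 * groupNorm 2 S a) +
          (-(2 * Q) + t ^ 2 * ∑ j ∈ S, h j ^ 2)
            / (2 * groupNorm 2 S a)
          = t ^ 2 * ((∑ j ∈ S, h j ^ 2) / groupNorm 2 S a) := by
        field_simp; ring
      linarith

/-- Shrinking an entry of `x` and moving a nearby point `y` in the opposite direction increases the
sum of the group norms at most by a small multiple of the step, if the group norm of `y` is bounded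
away from zero. -/
theorem exists_groupNorm_exchange_le (hp : p = 1 ∨ p = 2) {x y : E n} {ν : ℝ} (hν : 0 < ν)
    (hy : ν ≤ groupNorm p S y) (j : Fin n) :
    ∃ C : ℝ, ∀ t : ℝ, 0 < t → t ≤ 1 →
      groupNorm p S (y + EuclideanSpace.single j (t * x j)) - groupNorm p S y +
        (groupNorm p S (x - EuclideanSpace.single j (t * x j)) - groupNorm p S x)
        ≤ t * (|x j| * (2 * ‖x - y‖ / ν)) + t ^ 2 * C := by
  by_cases hj : j ∉ S
  · refine ⟨0, fun t ht _ => ?_⟩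
    have hne : ∀ i ∈ S, i ≠ j := fun i hi hij => hj (hij ▸ hi)
    rw [groupNorm_congr hp (y := y), groupNorm_congr hp (x := x - _) (y := x)]
    · have : 0 ≤ t * (|x j| * (2 * ‖x - y‖ / ν)) := by positivity
      simpa using this
    · intro i hi; simp [hne i hi]
    · intro i hi; simp [hne i hi]
  rw [not_not] at hj
  rcases hp with rfl | rfl
  · refine ⟨0, fun t ht ht1 => ?_⟩
    have h0 : 0 ≤ t * (|x j| * (2 * ‖x - y‖ / ν)) := by positivity
    simp only [groupNorm_one]
    rw [← Finset.sum_sub_distrib, ← Finset.sum_sub_distrib, ← Finset.sum_add_distrib]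
    refine (Finset.sum_nonpos fun i _ => ?_).trans (by linarith)
    simp only [PiLp.add_apply, PiLp.sub_apply]
    by_cases hij : i = j
    · subst hij
      simp only [PiLp.single_apply, if_true]
      have h1 := abs_add_le (y i) (t * x i)
      have h2 : |x i - t * x i| = (1 - t) * |x i| := by
        rw [show x i - t * x i = (1 - t) * x i by ring, abs_mul, abs_of_nonneg (by linarith)]
      rw [abs_mul, abs_of_pos ht] at h1
      linarith
    · simp [hij]
  · by_cases hxj : x j = 0
    · have h0 : EuclideanSpace.single j (0 : ℝ) = (0 : E n) := by ext i; simp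
      exact ⟨0, fun t _ _ => by simp [hxj, h0]⟩
    have hNy : 0 < groupNorm 2 S y := hν.trans_le hy
    have hxN := abs_le_groupNorm (p := 2) (Or.inr rfl) hj x
    have hNx : 0 < groupNorm 2 S x := (abs_pos.2 hxj).trans_le hxN
    refine ⟨x j ^ 2 / (2 * groupNorm 2 S y) + x j ^ 2 / (2 * groupNorm 2 S x),
      fun t ht ht1 => ?_⟩
    have h1 := groupNorm_two_add_le hNy (EuclideanSpace.single j (t * x j))
    have h2 := groupNorm_two_add_le hNx (-EuclideanSpace.single j (t * x j))
    rw [← sub_eq_add_neg] at h2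
    simp only [PiLp.neg_apply, PiLp.single_apply, mul_neg, mul_ite, mul_zero, ite_pow, ne_eq,
      neg_sq, OfNat.ofNat_ne_zero, not_false_eq_true, zero_pow, Finset.sum_ite_eq', hj, if_true,
      Finset.sum_neg_distrib] at h1 h2
    set A := groupNorm 2 S x with hA
    set B := groupNorm 2 S y with hB
    have hAB : |A - B| ≤ ‖x - y‖ := abs_groupNorm_two_sub_le S x y
    have hxy : |y j - x j| ≤ ‖x - y‖ := by
      rw [abs_sub_comm]; exact PiLp.norm_apply_le (x - y) j
    -- The first-order terms involve the difference of the `j`-th entries of the normalized vectors.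
    -- It splits into the change of the numerator and the change of the norm, each at most `‖x - y‖
    -- / ν` because `B ≥ ν` and `|x j| ≤ A`.
    have h3 : x j * (y j / B - x j / A) ≤ |x j| * (2 * ‖x - y‖ / ν) := by
      refine (le_abs_self _).trans ?_
      rw [abs_mul]
      gcongr
      have h4 : y j / B - x j / A = (y j - x j) / B + (x j / A) * ((A - B) / B) := by
        field_simp; ring
      have h5 : |x j / A| ≤ 1 := by
        rw [abs_div, abs_of_pos hNx, div_le_one hNx]; exact hxN
      have h6 : |(A - B) / B| ≤ ‖x - y‖ / ν := by
        rw [abs_div, abs_of_pos hNy]; gcongr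
      have h7 : |(y j - x j) / B| ≤ ‖x - y‖ / ν := by
        rw [abs_div, abs_of_pos hNy]; gcongr
      rw [h4]
      refine (abs_add_le _ _).trans ?_
      rw [abs_mul]
      have h8 : |x j / A| * |(A - B) / B| ≤ 1 * (‖x - y‖ / ν) :=
        mul_le_mul h5 h6 (abs_nonneg _) zero_le_one
      rw [two_mul, add_div]
      linarith
    have h9 : (2 * (y j * (t * x j)) + (t * x j) ^ 2) / (2 * B) +
        (-(2 * (x j * (t * x j))) + (t * x j) ^ 2) / (2 * A)
        = t * (x j * (y j / B - x j / A)) + t ^ 2 * (x j ^ 2 / (2 * B) + x j ^ 2 / (2 * A)) := by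
      field_simp; ring
    have h10 := mul_le_mul_of_nonneg_left h3 ht.le
    linarith

end GroupNorm

/-! ### Active indices of the capped functions. -/

section Index

theorem le_maxArgMax_apply {m : ℕ} [NeZero m] (g : Fin m → ℝ) (k : Fin m) :
    g k ≤ g (maxArgMax g) := by
  have := Finset.max'_mem (argMaxSet g) (argMaxSet_nonempty g)
  exact (Finset.mem_filter.1 this).2 k

theorem le_maxArgMax {m : ℕ} [NeZero m] {g : Fin m → ℝ} {i : Fin m} (h : ∀ k, g k ≤ g i) :
    i ≤ maxArgMax g :=
  Finset.le_max' _ _ (Finset.mem_filter.2 ⟨Finset.mem_univ _, h⟩)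

@[simp] theorem theta_zero (t μ : ℝ) : theta 0 t μ = 0 := rfl
@[simp] theorem theta_one (t μ : ℝ) : theta 1 t μ = t / μ - 1 := rfl
@[simp] theorem theta_two (t μ : ℝ) : theta 2 t μ = -t / μ - 1 := rfl

namespace Problem

variable {n L : ℕ} {P : Problem n L}

theorem idxI_eq_zero {x : E n} {j : Fin n} (hν : 0 < P.ν) (h : |x j| < P.ν) : P.idxI x j = 0 := by
  have h0 : theta 0 (x j) P.ν ≤ theta (P.idxI x j) (x j) P.ν :=
    le_maxArgMax_apply (fun i => theta i (x j) P.ν) 0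
  obtain ⟨h1, h2⟩ := abs_lt.1 h
  have h3 : x j / P.ν < 1 := (div_lt_one hν).2 h2
  have h4 : -x j / P.ν < 1 := (div_lt_one hν).2 (by linarith)
  generalize P.idxI x j = i at h0
  fin_cases i
  · rfl
  · simp at h0; linarith
  · simp at h0; linarith

theorem idxI_eq_one {x : E n} {j : Fin n} (hν : 0 < P.ν) (h : P.ν ≤ x j) : P.idxI x j = 1 := by
  have h3 : 1 ≤ x j / P.ν := (one_le_div hν).2 h
  have h4 : -x j / P.ν < 0 := div_neg_of_neg_of_pos (by linarith) hν
  have h0 : theta 1 (x j) P.ν ≤ theta (P.idxI x j) (x j) P.ν :=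
    le_maxArgMax_apply (fun i => theta i (x j) P.ν) 1
  have h1 : 1 ≤ P.idxI x j := by
    refine le_maxArgMax fun k => ?_
    fin_cases k
    · simp; linarith
    · simp
    · simp; linarith
  generalize P.idxI x j = i at h0 h1
  fin_cases i
  · simp at h1
  · rfl
  · simp at h0; linarith

theorem idxI_eq_two {x : E n} {j : Fin n} (hν : 0 < P.ν) (h : x j ≤ -P.ν) : P.idxI x j = 2 := by
  have h3 : 1 ≤ -x j / P.ν := (one_le_div hν).2 (by linarith)
  have h4 : x j / P.ν < 0 := div_neg_of_neg_of_pos (by linarith) hν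
  have h1 : 2 ≤ P.idxI x j := by
    refine le_maxArgMax fun k => ?_
    fin_cases k
    · simp; linarith
    · simp; linarith
    · simp
  generalize P.idxI x j = i at h1
  omega

theorem idxJ_eq_zero {x : E n} {l : Fin L} (hν : 0 < P.ν) (h : groupNorm P.p (P.G l) x < P.ν) :
    P.idxJ x l = 0 := by
  have h0 : theta (0 : Fin 2).castSucc (groupNorm P.p (P.G l) x) P.ν
      ≤ theta (P.idxJ x l).castSucc (groupNorm P.p (P.G l) x) P.ν :=
    le_maxArgMax_apply (fun i : Fin 2 => theta i.castSucc (groupNorm P.p (P.G l) x) P.ν) 0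
  have h3 : groupNorm P.p (P.G l) x / P.ν < 1 := (div_lt_one hν).2 h
  generalize P.idxJ x l = i at h0
  fin_cases i
  · rfl
  · simp at h0; linarith

theorem idxJ_eq_one {x : E n} {l : Fin L} (hν : 0 < P.ν) (h : P.ν ≤ groupNorm P.p (P.G l) x) :
    P.idxJ x l = 1 := by
  have h3 : 1 ≤ groupNorm P.p (P.G l) x / P.ν := (one_le_div hν).2 h
  have h1 : 1 ≤ P.idxJ x l := by
    refine le_maxArgMax fun k => ?_
    fin_cases k
    · simp; linarith
    · simp
  omega

theorem theta_le_theta_idxI (x : E n) (i : Fin 3) (j : Fin n) :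
    theta i (x j) P.ν ≤ theta (P.idxI x j) (x j) P.ν :=
  le_maxArgMax_apply (fun i => theta i (x j) P.ν) i

theorem theta_le_theta_idxJ (x : E n) (i : Fin 2) (l : Fin L) :
    theta i.castSucc (groupNorm P.p (P.G l) x) P.ν
      ≤ theta (P.idxJ x l).castSucc (groupNorm P.p (P.G l) x) P.ν :=
  le_maxArgMax_apply (fun i : Fin 2 => theta i.castSucc (groupNorm P.p (P.G l) x) P.ν) i

end Problem

end Index

theorem theta_continuous (i : Fin 3) (μ : ℝ) : Continuous fun t => theta i t μ := by
  fin_cases i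
  · exact continuous_const
  · exact (continuous_id.div_const μ).sub continuous_const
  · exact (continuous_id.neg.div_const μ).sub continuous_const

theorem theta_le_abs_div {μ : ℝ} (hμ : 0 < μ) (i : Fin 3) (t : ℝ) : theta i t μ ≤ |t| / μ := by
  have h0 : 0 ≤ |t| / μ := by positivity
  have h1 : t / μ ≤ |t| / μ := by gcongr; exact le_abs_self t
  have h2 : -t / μ ≤ |t| / μ := by gcongr; exact neg_le_abs t
  fin_cases i <;> simp <;> linarith

namespace Problem

variable {n L : ℕ} {P : Problem n L}

/-! ### Geometry of the box. -/

section Box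

theorem ordConnected_side (j : Fin n) :
    OrdConnected {t : ℝ | P.lo j ≤ (t : EReal) ∧ (t : EReal) ≤ P.hi j} :=
  ⟨fun _ hs _ ht _ hr => ⟨hs.1.trans (EReal.coe_le_coe_iff.2 hr.1),
    (EReal.coe_le_coe_iff.2 hr.2).trans ht.2⟩⟩

theorem convex_Ω : Convex ℝ P.Ω := by
  intro x hx y hy s t hs ht hst j
  exact (ordConnected_side (P := P) j).convex (hx j) (hy j) hs ht hst

theorem isClosed_Ω : IsClosed P.Ω := by
  have : P.Ω = ⋂ j, {x : E n | P.lo j ≤ (x j : EReal)} ∩ {x : E n | (x j : EReal) ≤ P.hi j} := by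
    ext x; simp [Ω]
  rw [this]
  have hc : ∀ j, Continuous fun x : E n => (x j : EReal) := fun j =>
    continuous_coe_real_ereal.comp (PiLp.continuous_apply 2 _ j)
  exact isClosed_iInter fun j =>
    (isClosed_le continuous_const (hc j)).inter (isClosed_le (hc j) continuous_const)

theorem Assumptions.zero_mem_side (hP : P.Assumptions) (j : Fin n) :
    (0 : ℝ) ∈ {t : ℝ | P.lo j ≤ (t : EReal) ∧ (t : EReal) ≤ P.hi j} :=
  ⟨by simpa using hP.lo_nonpos j, by simpa using hP.hi_nonneg j⟩

/-- The box is closed under shrinking entries. -/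
theorem Assumptions.mem_Ω_of_eq_mul (hP : P.Assumptions) {x z : E n} (hx : x ∈ P.Ω)
    (h : ∀ j, ∃ t ∈ Icc (0 : ℝ) 1, z j = t * x j) : z ∈ P.Ω := by
  intro j
  obtain ⟨t, ht, hz⟩ := h j
  have := (ordConnected_side (P := P) j).convex (hP.zero_mem_side j) (hx j)
    (sub_nonneg.2 ht.2) ht.1 (by ring)
  rw [hz]
  simpa using this

end Box

/-! ### Convexity, continuity and a lower bound for the loss. -/

section Regularity

theorem convexOn_abs_apply (j : Fin n) : ConvexOn ℝ univ fun x : E n => |x j| := by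
  refine ⟨convex_univ, fun x _ y _ s t hs ht _ => ?_⟩
  simp only [PiLp.add_apply, PiLp.smul_apply, smul_eq_mul]
  refine (abs_add_le _ _).trans_eq ?_
  rw [abs_mul, abs_mul, abs_of_nonneg hs, abs_of_nonneg ht]

theorem convexOn_finset_sum {ι : Type*} (s : Finset ι) {g : ι → E n → ℝ}
    (h : ∀ i ∈ s, ConvexOn ℝ univ (g i)) : ConvexOn ℝ univ fun x => ∑ i ∈ s, g i x := by
  refine ⟨convex_univ, fun x _ y _ a b ha hb hab => ?_⟩
  simp only [smul_eq_mul, Finset.mul_sum]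
  rw [← Finset.sum_add_distrib]
  exact Finset.sum_le_sum fun i hi => (h i hi).2 (mem_univ _) (mem_univ _) ha hb hab

theorem Assumptions.convexOn_f (hP : P.Assumptions) : ConvexOn ℝ univ P.f :=
  hP.convex_fn.add hP.convex_fs

theorem Assumptions.convexOn_fnbar (hP : P.Assumptions) {μ : ℝ} (hμ : 0 < μ) :
    ConvexOn ℝ univ fun x => P.fnbar x μ := by
  refine (hP.convex_fn.add (ConvexOn.smul (div_nonneg hP.lam1_pos.le hμ.le)
    (convexOn_finset_sum Finset.univ fun j _ => convexOn_abs_apply j))).add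
    (ConvexOn.smul (div_nonneg hP.lam2_nonneg hμ.le)
      (convexOn_finset_sum Finset.univ fun l _ => ConvexOn.smul (hP.w_nonneg l)
        (convexOn_groupNorm hP.p_eq (P.G l))))

theorem Assumptions.continuous_f (hP : P.Assumptions) : Continuous P.f :=
  continuous_of_convexOn_univ hP.convexOn_f

theorem Assumptions.continuous_fnbar (hP : P.Assumptions) {μ : ℝ} (hμ : 0 < μ) :
    Continuous fun x => P.fnbar x μ :=
  continuous_of_convexOn_univ (hP.convexOn_fnbar hμ)

theorem Assumptions.continuous_groupNorm (hP : P.Assumptions) (l : Fin L) :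
    Continuous (groupNorm P.p (P.G l)) :=
  continuous_of_convexOn_univ (convexOn_groupNorm hP.p_eq _)

theorem Assumptions.continuous_Theta (hP : P.Assumptions) (I : Fin n → Fin 3) (J : Fin L → Fin 2)
    (μ : ℝ) : Continuous fun x => P.Theta I J x μ := by
  refine (continuous_const.mul (continuous_finsetSum _ fun j _ =>
    (theta_continuous _ μ).comp (PiLp.continuous_apply 2 _ j))).add
    (continuous_const.mul (continuous_finsetSum _ fun l _ =>
      continuous_const.mul ((theta_continuous _ μ).comp (hP.continuous_groupNorm l))))

theorem Assumptions.continuous_gradient_fs (hP : P.Assumptions) : Continuous (∇ P.fs) := by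
  refine (LipschitzWith.of_dist_le_mul (K := ⟨P.Ls, hP.Ls_pos.le⟩) fun x y => ?_).continuous
  rw [dist_eq_norm, dist_eq_norm]
  exact hP.lipschitz_grad x y

theorem Assumptions.exists_le_f (hP : P.Assumptions) {x₀ : E n} (h₀ : x₀ ∈ P.Ω) :
    ∃ m, ∀ x ∈ P.Ω, m ≤ P.f x := by
  have hc : IsCompact {x ∈ P.Ω | P.f x ≤ P.f x₀} := by
    refine Metric.isCompact_of_isClosed_isBounded ?_ (hP.level_bounded _)
    exact isClosed_Ω.inter (isClosed_le hP.continuous_f continuous_const)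
  obtain ⟨a, -, hmin⟩ := hc.exists_isMinOn ⟨x₀, h₀, le_rfl⟩ hP.continuous_f.continuousOn
  refine ⟨P.f a, fun x hx => ?_⟩
  by_cases h : P.f x ≤ P.f x₀
  · exact hmin (show x ∈ {x ∈ P.Ω | P.f x ≤ P.f x₀} from ⟨hx, h⟩)
  · have h1 : P.f a ≤ P.f x₀ := hmin (show x₀ ∈ {x ∈ P.Ω | P.f x ≤ P.f x₀} from ⟨h₀, le_rfl⟩)
    linarith

end Regularity

/-! ### The relaxed objective. -/

section Capped

theorem fbar_eq (x : E n) : P.fbar x = P.fnbar x P.ν + P.fs x := by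
  rw [fbar, fnbar, f]; ring

/-- The objective of the capped-`ℓ₁` relaxation. -/
noncomputable def capped (P : Problem n L) (x : E n) : ℝ := P.fbar x - P.Theta (P.idxI x) (P.idxJ x) x P.ν

/-- Each piece `theta i t ν` is at most `|t| / ν`, so the capped penalty is nonnegative. The lower
bound of `f` on the box thereby carries over to the energy. -/
theorem Assumptions.f_le_capped (hP : P.Assumptions) (x : E n) : P.f x ≤ P.capped x := by
  have h1 : ∑ j, theta (P.idxI x j) (x j) P.ν ≤ (∑ j, |x j|) / P.ν := by
    rw [Finset.sum_div]
    exact Finset.sum_le_sum fun j _ => theta_le_abs_div hP.ν_pos _ _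
  have h2 : ∑ l, P.w l * theta (P.idxJ x l).castSucc (groupNorm P.p (P.G l) x) P.ν
      ≤ (∑ l, P.w l * groupNorm P.p (P.G l) x) / P.ν := by
    rw [Finset.sum_div]
    refine Finset.sum_le_sum fun l _ => ?_
    rw [mul_div_assoc]
    refine mul_le_mul_of_nonneg_left ?_ (hP.w_nonneg l)
    refine (theta_le_abs_div hP.ν_pos _ _).trans_eq ?_
    rw [abs_of_nonneg (groupNorm_nonneg hP.p_eq _ _)]
  have h3 := mul_le_mul_of_nonneg_left h1 hP.lam1_pos.le
  have h4 := mul_le_mul_of_nonneg_left h2 hP.lam2_nonneg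
  rw [capped, fbar, Theta]
  rw [mul_div_assoc'] at h3 h4
  rw [div_mul_eq_mul_div, div_mul_eq_mul_div]
  linarith

theorem Assumptions.Theta_le (hP : P.Assumptions) (I : Fin n → Fin 3) (J : Fin L → Fin 2)
    (x : E n) : P.Theta I J x P.ν ≤ P.Theta (P.idxI x) (P.idxJ x) x P.ν := by
  refine add_le_add (mul_le_mul_of_nonneg_left ?_ hP.lam1_pos.le)
    (mul_le_mul_of_nonneg_left ?_ hP.lam2_nonneg)
  · exact Finset.sum_le_sum fun j _ => theta_le_theta_idxI x _ j
  · exact Finset.sum_le_sum fun l _ =>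
      mul_le_mul_of_nonneg_left (theta_le_theta_idxJ x _ l) (hP.w_nonneg l)

end Capped

/-! ### A single step at the final parameter. -/

section Step

/-- One step of the DC algorithm at the final parameter `ν`: from `x`, with extrapolated point `y`
and subgradient `ξ`, to `x'`. -/
structure IsStep (P : Problem n L) (x y ξ x' : E n) : Prop where
  mem : x ∈ P.Ω
  mem' : x' ∈ P.Ω
  subgrad : ξ ∈ subdiff (fun z => P.Theta (P.idxI x) (P.idxJ x) z P.ν) x
  argmin : IsMinOn (fun z => P.model (P.idxI x) (P.idxJ x) ξ z P.ν y x + P.Ls / 2 * ‖z - y‖ ^ 2)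
    P.Ω x'

variable {x y ξ x' : E n}

theorem IsStep.fnbar_le (h : P.IsStep x y ξ x') (hP : P.Assumptions) {z : E n} (hz : z ∈ P.Ω) :
    P.fnbar x' P.ν ≤ P.fnbar z P.ν + ⟪∇ P.fs y, z - x'⟫_ℝ - ⟪ξ, z - x'⟫_ℝ
      + P.Ls * ⟪x' - y, z - x'⟫_ℝ := by
  have hlin : ConvexOn ℝ univ fun z : E n => ⟪∇ P.fs y - ξ, z⟫_ℝ :=
    ((innerSL ℝ (∇ P.fs y - ξ)).toLinearMap).convexOn convex_univ
  have hg := (hP.convexOn_fnbar hP.ν_pos).add hlin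
  have hmin : IsMinOn (fun z => ((fun x => P.fnbar x P.ν) + fun z : E n => ⟪∇ P.fs y - ξ, z⟫_ℝ) z
      + P.Ls / 2 * ‖z - y‖ ^ 2) P.Ω x' := by
    intro z hz
    have := h.argmin hz
    simp only [mem_ofPred_eq, model, Pi.add_apply, inner_sub_left, inner_sub_right] at this ⊢
    linarith
  have := le_add_inner_of_isMinOn_prox hg convex_Ω h.mem' hmin hz
  simp only [Pi.add_apply, inner_sub_left, inner_sub_right] at this ⊢
  linarith

/-- The sum of five inequalities: the step inequality at `z = x`, the descent lemma for `f_s` from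
`y` to `x'`, convexity of `f_s` between `y` and `x`, the subgradient inequality for `ξ`, and
maximality of the indices at `x'`. The quadratic terms combine through the expansion of `‖x - y‖²`
about `x'`. -/
theorem IsStep.capped_add_le (h : P.IsStep x y ξ x') (hP : P.Assumptions) :
    P.capped x' + P.Ls / 2 * ‖x' - x‖ ^ 2 ≤ P.capped x + P.Ls / 2 * ‖x - y‖ ^ 2 := by
  have h1 := h.fnbar_le hP h.mem
  have h2 := le_add_inner_add_sq_of_lipschitz_gradient hP.differentiable_fs hP.lipschitz_grad x' y
  have h3 := gradient_mem_subdiff hP.convex_fs hP.differentiable_fs y x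
  have h4 := h.subgrad x'
  have h5 := hP.Theta_le (P.idxI x) (P.idxJ x) x'
  have h6 : ‖x - y‖ ^ 2 = ‖x' - y‖ ^ 2 + 2 * ⟪x' - y, x - x'⟫_ℝ + ‖x' - x‖ ^ 2 := by
    rw [show x - y = (x' - y) + (x - x') by abel, norm_add_sq_real, norm_sub_rev x x']
  rw [capped, capped, fbar_eq, fbar_eq, h6]
  simp only [inner_sub_right] at h1 h2 h3 h4 ⊢
  linarith

/-- One group's share in the test perturbation `x + e`, `x' - e` of `IsStep.apply_eq_zero`. If the
piece at `x` is constant, shrinking `x'` can only help; otherwise the exchange estimate for group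
norms applies. -/
theorem exists_theta_groupNorm_exchange_le (hP : P.Assumptions) (x x' : E n) (j : Fin n)
    (l : Fin L) :
    ∃ C : ℝ, ∀ t : ℝ, 0 < t → t ≤ 1 →
      theta (P.idxJ x l).castSucc
          (groupNorm P.p (P.G l) (x + EuclideanSpace.single j (t * x' j))) P.ν
        - theta (P.idxJ x l).castSucc (groupNorm P.p (P.G l) x) P.ν
        + (groupNorm P.p (P.G l) (x' - EuclideanSpace.single j (t * x' j))
          - groupNorm P.p (P.G l) x') / P.ν
        ≤ t * (|x' j| * (2 * ‖x' - x‖ / P.ν) / P.ν) + t ^ 2 * C := by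
  have hν := hP.ν_pos
  rcases lt_or_ge (groupNorm P.p (P.G l) x) P.ν with hl | hl
  · refine ⟨0, fun t ht ht1 => ?_⟩
    rw [idxJ_eq_zero hν hl]
    have h1 : groupNorm P.p (P.G l) (x' - EuclideanSpace.single j (t * x' j))
        ≤ groupNorm P.p (P.G l) x' := by
      refine groupNorm_le_of_abs_le hP.p_eq fun i _ => ?_
      by_cases hij : i = j
      · subst hij
        simp only [PiLp.sub_apply, PiLp.single_apply, if_true]
        rw [show x' i - t * x' i = (1 - t) * x' i by ring, abs_mul, abs_of_nonneg (by linarith)]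
        exact mul_le_of_le_one_left (abs_nonneg _) (by linarith)
      · simp [hij]
    have h2 : (groupNorm P.p (P.G l) (x' - EuclideanSpace.single j (t * x' j))
        - groupNorm P.p (P.G l) x') / P.ν ≤ 0 := div_nonpos_of_nonpos_of_nonneg (by linarith) hν.le
    have h3 : 0 ≤ t * (|x' j| * (2 * ‖x' - x‖ / P.ν) / P.ν) := by positivity
    simp only [Fin.castSucc_zero, theta_zero]
    linarith
  · obtain ⟨C, hC⟩ := exists_groupNorm_exchange_le (x := x') hP.p_eq hν hl j
    refine ⟨C / P.ν, fun t ht ht1 => ?_⟩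
    rw [idxJ_eq_one hν hl]
    have h1 := div_le_div_of_nonneg_right (hC t ht ht1) hν.le
    simp only [show (1 : Fin 2).castSucc = (1 : Fin 3) from rfl, theta_one]
    refine le_trans (le_of_eq ?_) (h1.trans (le_of_eq ?_))
    · field_simp; ring
    · field_simp

/-- An entry of absolute value less than `ν` vanishes after one step, if the step is short. -/
theorem IsStep.apply_eq_zero (h : P.IsStep x y ξ x') (hP : P.Assumptions) {j : Fin n}
    (hj : |x j| < P.ν)
    (hsmall : P.Ls * ‖y - x‖ + P.Ls * ‖x' - y‖ +
      P.lam2 * (∑ l, P.w l) * (2 * ‖x' - x‖ / P.ν / P.ν) < P.lam1 / P.ν - P.Lf) :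
    x' j = 0 := by
  have hν := hP.ν_pos
  by_contra hne
  have hpos : 0 < |x' j| := abs_pos.2 hne
  choose C hC using exists_theta_groupNorm_exchange_le hP x x' j
  suffices hs : 0 ≤ |x' j| * (P.Lf + P.Ls * ‖y - x‖ + P.Ls * ‖x' - y‖ - P.lam1 / P.ν +
      P.lam2 * (∑ l, P.w l) * (2 * ‖x' - x‖ / P.ν / P.ν)) by
    have := nonneg_of_mul_nonneg_right hs hpos
    linarith
  refine nonneg_of_forall_mul_add_sq_mul (B := P.lam2 * ∑ l, P.w l * C l) fun t ht ht1 => ?_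
  -- The step inequality is tested at `x' - e`, and `ξ` at `x + e`, so that the two terms with `ξ`
  -- cancel.
  set e : E n := EuclideanSpace.single j (t * x' j) with he
  have hinner : ∀ v : E n, ⟪v, e⟫_ℝ = t * (x' j * v j) := fun v => by
    rw [he, EuclideanSpace.inner_single_right]; simp; ring
  have hz : x' - e ∈ P.Ω := by
    refine hP.mem_Ω_of_eq_mul h.mem' fun i => ?_
    by_cases hij : i = j
    · subst hij
      exact ⟨1 - t, ⟨by linarith, by linarith⟩, by simp [he]; ring⟩
    · exact ⟨1, ⟨zero_le_one, le_rfl⟩, by simp [he, hij]⟩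
  have hvi := h.fnbar_le hP hz
  rw [show x' - e - x' = -e by abel] at hvi
  simp only [inner_neg_right, hinner] at hvi
  obtain ⟨ζ, hζ⟩ := subdiff_nonempty hP.convex_fn (x' - e)
  have hfn := hζ x'
  rw [show x' - (x' - e) = e by abel, hinner] at hfn
  -- The extrapolated point `y` may lie outside the box, where the bound `L_f` is not available. The
  -- gradient is therefore taken at `x`, at the cost of the error `Ls * ‖y - x‖`.
  have hLf := hP.Lf_bound_split _ hz _ h.mem (ζ + ∇ P.fs x)
    (Set.add_mem_add hζ (gradient_mem_subdiff hP.convex_fs hP.differentiable_fs x)) j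
  have hgrad : |(∇ P.fs y - ∇ P.fs x) j| ≤ P.Ls * ‖y - x‖ :=
    (PiLp.norm_apply_le (∇ P.fs y - ∇ P.fs x) j).trans (hP.lipschitz_grad y x)
  have hprox : |(x' - y) j| ≤ ‖x' - y‖ := PiLp.norm_apply_le (x' - y) j
  have habs : ∑ i, |(x' - e) i| = ∑ i, |x' i| - t * |x' j| := by
    suffices hd : ∑ i, |(x' - e) i| - ∑ i, |x' i| = -(t * |x' j|) by linarith
    rw [← Finset.sum_sub_distrib, Finset.sum_eq_single j]
    · simp only [he, PiLp.sub_apply, PiLp.single_apply, if_true]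
      rw [show x' j - t * x' j = (1 - t) * x' j by ring, abs_mul, abs_of_nonneg (by linarith)]
      ring
    · intro i _ hij; simp [he, hij]
    · simp
  have hsub := h.subgrad (x + e)
  simp only [add_sub_cancel_left, hinner] at hsub
  -- Here `|x j| < ν` enters: the piece at entry `j` is constant, so nothing offsets the gain `t *
  -- |x' j| * λ₁ / ν`.
  have hth1 : ∑ i, theta (P.idxI x i) ((x + e) i) P.ν = ∑ i, theta (P.idxI x i) (x i) P.ν := by
    refine Finset.sum_congr rfl fun i _ => ?_
    by_cases hij : i = j
    · subst hij; rw [idxI_eq_zero hν hj]; rfl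
    · simp [he, hij]
  have hgr : ∑ l, P.w l * theta (P.idxJ x l).castSucc (groupNorm P.p (P.G l) (x + e)) P.ν
      - ∑ l, P.w l * theta (P.idxJ x l).castSucc (groupNorm P.p (P.G l) x) P.ν
      + (∑ l, P.w l * groupNorm P.p (P.G l) (x' - e)
        - ∑ l, P.w l * groupNorm P.p (P.G l) x') / P.ν
      ≤ (∑ l, P.w l) * (t * (|x' j| * (2 * ‖x' - x‖ / P.ν) / P.ν)) + t ^ 2 * ∑ l, P.w l * C l := by
    rw [← Finset.sum_sub_distrib, ← Finset.sum_sub_distrib, Finset.sum_div,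
      ← Finset.sum_add_distrib, Finset.sum_mul, Finset.mul_sum, ← Finset.sum_add_distrib]
    refine Finset.sum_le_sum fun l _ => ?_
    have := mul_le_mul_of_nonneg_left (hC l t ht ht1) (hP.w_nonneg l)
    refine le_trans (le_of_eq ?_) (this.trans (le_of_eq ?_)) <;> ring
  have hgr' := mul_le_mul_of_nonneg_left hgr hP.lam2_nonneg
  have hb1 : -(x' j * (ζ + ∇ P.fs x) j) ≤ |x' j| * P.Lf := by
    refine (neg_le_abs _).trans ?_
    rw [abs_mul]; gcongr
  have hb2 : -(x' j * (∇ P.fs y - ∇ P.fs x) j) ≤ |x' j| * (P.Ls * ‖y - x‖) := by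
    refine (neg_le_abs _).trans ?_
    rw [abs_mul]; gcongr
  have hb3 : -(x' j * (x' - y) j) ≤ |x' j| * ‖x' - y‖ := by
    refine (neg_le_abs _).trans ?_
    rw [abs_mul]; gcongr
  have hb1' := mul_le_mul_of_nonneg_left hb1 ht.le
  have hb2' := mul_le_mul_of_nonneg_left hb2 ht.le
  have hb3' := mul_le_mul_of_nonneg_left (mul_le_mul_of_nonneg_left hb3 hP.Ls_pos.le) ht.le
  simp only [fnbar, habs] at hvi
  simp only [Theta, hth1] at hsub
  simp only [PiLp.add_apply, PiLp.sub_apply] at hb1' hb2' hb3' hvi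
  rw [div_mul_eq_mul_div P.lam2, div_mul_eq_mul_div P.lam2] at hvi
  ring_nf at hvi hsub hgr' hb1' hb2' hb3' hfn ⊢
  linarith

end Step

end Problem

theorem inner_eq_sum {n : ℕ} (x y : E n) : ⟪x, y⟫_ℝ = ∑ j, x j * y j := by
  rw [PiLp.inner_apply]
  exact Finset.sum_congr rfl fun j _ => by simp [mul_comm]

/-- The pieces are affine, so the linearization has no remainder. -/
theorem inner_gradient_theta {n : ℕ} (i : Fin 3) (j : Fin n) (ν : ℝ) (x h : E n) :
    ⟪∇ (fun z : E n => theta i (z j) ν) x, h⟫_ℝ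
      = theta i (x j + h j) ν - theta i (x j) ν := by
  have hd : HasFDerivAt (fun z : E n => z j) (EuclideanSpace.proj j : E n →L[ℝ] ℝ) x :=
    (EuclideanSpace.proj j : E n →L[ℝ] ℝ).hasFDerivAt
  rw [← InnerProductSpace.toDual_apply_apply (𝕜 := ℝ), gradient,
    LinearIsometryEquiv.apply_symm_apply]
  fin_cases i
  · simp
  · have h1 : HasFDerivAt (fun z : E n => theta 1 (z j) ν)
        (ν⁻¹ • (EuclideanSpace.proj j : E n →L[ℝ] ℝ)) x := by
      refine ((hd.const_mul ν⁻¹).sub_const 1).congr_of_eventuallyEq (.of_forall fun z => ?_)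
      simp [div_eq_inv_mul]
    simp only [show (⟨1, by norm_num⟩ : Fin 3) = 1 from rfl]
    rw [h1.fderiv]
    simp; ring
  · have h1 : HasFDerivAt (fun z : E n => theta 2 (z j) ν)
        ((-ν⁻¹) • (EuclideanSpace.proj j : E n →L[ℝ] ℝ)) x := by
      refine ((hd.const_mul (-ν⁻¹)).sub_const 1).congr_of_eventuallyEq (.of_forall fun z => ?_)
      simp [div_eq_inv_mul]
    simp only [show (⟨2, by norm_num⟩ : Fin 3) = 2 from rfl]
    rw [h1.fderiv]
    simp; ring

theorem nz_le_nz {s t : ℝ} (h : t = 0 → s = 0) : nz s ≤ nz t := by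
  unfold nz
  split_ifs with h1 h2 h2
  · exact le_rfl
  · exact zero_le_one
  · exact absurd (h h2) h1
  · exact le_rfl

namespace Problem

variable {n L : ℕ} {P : Problem n L}

/-! ### From the fixed-point inequality to optimality. -/

section Stationary

variable {a : E n}

/-- If the nonzero entries of `a` have absolute value at least `ν`, a group with index `0` is
entirely zero. -/
theorem Assumptions.eq_zero_of_groupNorm_lt (hP : P.Assumptions)
    (hgap : ∀ j, a j ≠ 0 → P.ν ≤ |a j|) {l : Fin L} (hl : groupNorm P.p (P.G l) a < P.ν) {j : Fin n}
    (hj : j ∈ P.G l) : a j = 0 := by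
  by_contra h
  exact absurd (hgap j h) (not_le.2 ((abs_le_groupNorm hP.p_eq hj a).trans_lt hl))

/-- On the support the gap selects the affine piece with the same slope at `a j` as `|·| / ν`. The
opposite displacements then cancel to first order. -/
theorem exists_abs_add_theta_le (hν : 0 < P.ν) (hgap : ∀ j, a j ≠ 0 → P.ν ≤ |a j|)
    {h : E n} (hah : ∀ j, a j = 0 → h j = 0) (j : Fin n) :
    ∃ C : ℝ, ∀ t : ℝ, (|(a + t • h) j| - |a j|) / P.ν
      + (theta (P.idxI a j) ((a - t • h) j) P.ν - theta (P.idxI a j) (a j) P.ν) ≤ t ^ 2 * C := by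
  by_cases ha : a j = 0
  · refine ⟨0, fun t => ?_⟩
    simp [ha, hah j ha]
  refine ⟨h j ^ 2 / (2 * |a j|) / P.ν, fun t => ?_⟩
  have h1 := abs_add_le_of_ne_zero ha (t * h j)
  have h2 : (2 * (a j * (t * h j)) + (t * h j) ^ 2) / (2 * |a j|)
      = a j / |a j| * (t * h j) + t ^ 2 * (h j ^ 2 / (2 * |a j|)) := by
    have := abs_pos.2 ha
    field_simp
  rw [h2] at h1
  simp only [PiLp.add_apply, PiLp.sub_apply, PiLp.smul_apply, smul_eq_mul]
  rcases le_abs'.1 (hgap j ha) with hs | hs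
  · have h3 : a j / |a j| = -1 := by rw [abs_of_neg (by linarith), div_neg, div_self ha]
    rw [h3] at h1
    rw [idxI_eq_two hν hs, theta_two, theta_two]
    calc _ = (|a j + t * h j| - |a j| + t * h j) / P.ν := by field_simp; ring
      _ ≤ (t ^ 2 * (h j ^ 2 / (2 * |a j|))) / P.ν := by gcongr; linarith
      _ = _ := by ring
  · have h3 : a j / |a j| = 1 := by rw [abs_of_pos (by linarith), div_self ha]
    rw [h3] at h1
    rw [idxI_eq_one hν hs, theta_one, theta_one]
    calc _ = (|a j + t * h j| - |a j| - t * h j) / P.ν := by field_simp; ring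
      _ ≤ (t ^ 2 * (h j ^ 2 / (2 * |a j|))) / P.ν := by gcongr; linarith
      _ = _ := by ring

theorem Assumptions.exists_groupNorm_add_theta_le (hP : P.Assumptions)
    (hgap : ∀ j, a j ≠ 0 → P.ν ≤ |a j|)
    {h : E n} (hah : ∀ j, a j = 0 → h j = 0) (l : Fin L) :
    ∃ C : ℝ, ∀ t : ℝ, (groupNorm P.p (P.G l) (a + t • h) - groupNorm P.p (P.G l) a) / P.ν
      + (theta (P.idxJ a l).castSucc (groupNorm P.p (P.G l) (a - t • h)) P.ν
        - theta (P.idxJ a l).castSucc (groupNorm P.p (P.G l) a) P.ν) ≤ t ^ 2 * C := by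
  have hν := hP.ν_pos
  rcases lt_or_ge (groupNorm P.p (P.G l) a) P.ν with hl | hl
  · refine ⟨0, fun t => ?_⟩
    have h0 : ∀ j ∈ P.G l, a j = 0 := fun j => hP.eq_zero_of_groupNorm_lt hgap hl
    rw [idxJ_eq_zero hν hl, groupNorm_congr hP.p_eq (x := a + t • h) (y := a)]
    · simp
    · intro j hj; simp [hah j (h0 j hj)]
  · obtain ⟨C, hC⟩ := exists_groupNorm_second_difference_le (S := P.G l) (a := a) (h := h) hP.p_eq
      fun j _ => hah j
    refine ⟨C / P.ν, fun t => ?_⟩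
    rw [idxJ_eq_one hν hl, show (1 : Fin 2).castSucc = (1 : Fin 3) from rfl, theta_one, theta_one]
    calc _ = (groupNorm P.p (P.G l) (a + t • h) + groupNorm P.p (P.G l) (a - t • h)
          - 2 * groupNorm P.p (P.G l) a) / P.ν := by field_simp; ring
      _ ≤ (t ^ 2 * C) / P.ν := by gcongr; linarith [hC t]
      _ = _ := by ring

/-- A fixed point of the DC step minimizes the loss among the points of the box with no additional
nonzero entries. -/
theorem Assumptions.f_le_of_fnbar_le (hP : P.Assumptions) (ha : a ∈ P.Ω)
    (hgap : ∀ j, a j ≠ 0 → P.ν ≤ |a j|)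
    (hcrit : ∀ z ∈ P.Ω, P.fnbar a P.ν ≤ P.fnbar z P.ν + ⟪∇ P.fs a, z - a⟫_ℝ
      + (P.Theta (P.idxI a) (P.idxJ a) (a + a - z) P.ν - P.Theta (P.idxI a) (P.idxJ a) a P.ν))
    {z : E n} (hz : z ∈ P.Ω) (hza : ∀ j, a j = 0 → z j = 0) : P.f a ≤ P.f z := by
  have hah : ∀ j, a j = 0 → (z - a) j = 0 := fun j hj => by simp [hj, hza j hj]
  choose C hC using exists_abs_add_theta_le hP.ν_pos hgap hah
  choose D hD using hP.exists_groupNorm_add_theta_le hgap hah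
  suffices hs : 0 ≤ P.f z - P.f a by linarith
  refine nonneg_of_forall_mul_add_sq_mul
    (B := P.lam1 * ∑ j, C j + P.lam2 * ∑ l, P.w l * D l) fun t ht ht1 => ?_
  have hw : a + t • (z - a) = (1 - t) • a + t • z := by module
  have hwΩ : a + t • (z - a) ∈ P.Ω := by
    rw [hw]; exact convex_Ω ha hz (by linarith) ht.le (by ring)
  have h1 : P.f (a + t • (z - a)) ≤ (1 - t) * P.f a + t * P.f z := by
    rw [hw]; exact hP.convexOn_f.2 (mem_univ _) (mem_univ _) (by linarith) ht.le (by ring)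
  -- At the point `a + t • (z - a)` the fixed-point inequality involves the reflected point `a - t •
  -- (z - a)`, so the penalties form second differences of order `t²`.
  have h2 := hcrit _ hwΩ
  have h3 := gradient_mem_subdiff hP.convex_fs hP.differentiable_fs a (a + t • (z - a))
  rw [show a + a - (a + t • (z - a)) = a - t • (z - a) by abel] at h2
  have h4 : (∑ j, |(a + t • (z - a)) j| - ∑ j, |a j|) / P.ν
      + (∑ j, theta (P.idxI a j) ((a - t • (z - a)) j) P.ν - ∑ j, theta (P.idxI a j) (a j) P.ν)
      ≤ t ^ 2 * ∑ j, C j := by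
    rw [← Finset.sum_sub_distrib, ← Finset.sum_sub_distrib, Finset.sum_div,
      ← Finset.sum_add_distrib, Finset.mul_sum]
    exact Finset.sum_le_sum fun j _ => hC j t
  have h5 : (∑ l, P.w l * groupNorm P.p (P.G l) (a + t • (z - a))
        - ∑ l, P.w l * groupNorm P.p (P.G l) a) / P.ν
      + (∑ l, P.w l * theta (P.idxJ a l).castSucc (groupNorm P.p (P.G l) (a - t • (z - a))) P.ν
        - ∑ l, P.w l * theta (P.idxJ a l).castSucc (groupNorm P.p (P.G l) a) P.ν)
      ≤ t ^ 2 * ∑ l, P.w l * D l := by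
    rw [← Finset.sum_sub_distrib, ← Finset.sum_sub_distrib, Finset.sum_div,
      ← Finset.sum_add_distrib, Finset.mul_sum]
    refine Finset.sum_le_sum fun l _ => ?_
    have := mul_le_mul_of_nonneg_left (hD l t) (hP.w_nonneg l)
    refine le_trans (le_of_eq ?_) (this.trans (le_of_eq ?_)) <;> ring
  have h4' := mul_le_mul_of_nonneg_left h4 hP.lam1_pos.le
  have h5' := mul_le_mul_of_nonneg_left h5 hP.lam2_nonneg
  simp only [f] at h1 ⊢
  simp only [fnbar, Theta] at h2
  ring_nf at h1 h2 h3 h4' h5' ⊢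
  linarith

/-- First-order optimality of `a` for the loss on the points of the box that vanish where `a`
does. -/
theorem Assumptions.exists_mem_subdiff_f (hP : P.Assumptions) (ha : a ∈ P.Ω)
    (hmin : ∀ z ∈ P.Ω, (∀ j, a j = 0 → z j = 0) → P.f a ≤ P.f z) :
    ∃ ζ ∈ subdiff P.f a, ∀ z ∈ P.Ω, (∀ j, a j = 0 → z j = 0) → 0 ≤ ⟪ζ, z - a⟫_ℝ := by
  have hC : Convex ℝ (P.Ω ∩ {z : E n | ∀ j, a j = 0 → z j = 0}) := by
    refine convex_Ω.inter fun x hx y hy s t _ _ _ j hj => ?_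
    simp [hx j hj, hy j hj]
  obtain ⟨ζ, hζ, h⟩ := exists_mem_subdiff_of_isMinOn hP.convexOn_f hC
    (show a ∈ P.Ω ∩ {z : E n | ∀ j, a j = 0 → z j = 0} from ⟨ha, fun _ => id⟩)
    (fun z hz => hmin z hz.1 hz.2)
  exact ⟨ζ, hζ, fun z hz hza => h z ⟨hz, hza⟩⟩

/-- Near `a` no nonzero entry vanishes, so no sparsity term drops. A nearby point either keeps the
zeros of `a`, where `hmin` applies, or pays an extra `λ₁`, more than `f` can decrease there by
continuity. -/
theorem Assumptions.isStrongLocalMin (hP : P.Assumptions) (ha : a ∈ P.Ω)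
    (hgap : ∀ j, a j ≠ 0 → P.ν ≤ |a j|)
    (hmin : ∀ z ∈ P.Ω, (∀ j, a j = 0 → z j = 0) → P.f a ≤ P.f z) : P.IsStrongLocalMin a := by
  refine ⟨ha, ?_, hgap⟩
  have h1 : ∀ᶠ z in 𝓝 a, P.f a - P.lam1 < P.f z :=
    hP.continuous_f.continuousAt.eventually (lt_mem_nhds (by linarith [hP.lam1_pos]))
  have h2 : ∀ᶠ z : E n in 𝓝 a, ∀ j, a j ≠ 0 → z j ≠ 0 := by
    rw [eventually_all]
    intro j
    by_cases hj : a j = 0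
    · simp [hj]
    · filter_upwards [(PiLp.continuous_apply 2 (fun _ : Fin n => ℝ) j).continuousAt.eventually_ne hj]
        with z hz _ using hz
  filter_upwards [mem_nhdsWithin_of_mem_nhds h1, mem_nhdsWithin_of_mem_nhds h2,
    self_mem_nhdsWithin] with z hz1 hz2 hzΩ
  have hnz : ∀ j, nz (a j) ≤ nz (z j) := fun j => nz_le_nz fun h => by
    by_contra h'; exact hz2 j h' h
  have hgr : ∑ l, P.w l * nz (groupNorm P.p (P.G l) a)
      ≤ ∑ l, P.w l * nz (groupNorm P.p (P.G l) z) := by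
    refine Finset.sum_le_sum fun l _ => mul_le_mul_of_nonneg_left (nz_le_nz fun h => ?_)
      (hP.w_nonneg l)
    refine groupNorm_eq_zero hP.p_eq fun j hj => ?_
    by_contra h'
    have := abs_le_groupNorm hP.p_eq hj z
    rw [h] at this
    exact hz2 j h' (abs_nonpos_iff.1 this)
  have hgr' := mul_le_mul_of_nonneg_left hgr hP.lam2_nonneg
  rw [F0, F0]
  by_cases hA : ∀ j, a j = 0 → z j = 0
  · have h3 := hmin z hzΩ hA
    have h4 : ∑ j, nz (a j) ≤ ∑ j, nz (z j) := Finset.sum_le_sum fun j _ => hnz j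
    have h4' := mul_le_mul_of_nonneg_left h4 hP.lam1_pos.le
    linarith
  · push Not at hA
    obtain ⟨j, hj, hzj⟩ := hA
    have h4 : ∑ j, nz (a j) + 1 ≤ ∑ j, nz (z j) := by
      have h5 : 1 ≤ nz (z j) - nz (a j) := by simp [nz, hj, hzj]
      have h6 : nz (z j) - nz (a j) ≤ ∑ j, (nz (z j) - nz (a j)) :=
        Finset.single_le_sum (f := fun j => nz (z j) - nz (a j))
          (fun i _ => sub_nonneg.2 (hnz i)) (Finset.mem_univ j)
      rw [Finset.sum_sub_distrib] at h6
      linarith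
    have h4' := mul_le_mul_of_nonneg_left h4 hP.lam1_pos.le
    linarith

theorem Assumptions.isSwdStationary (hP : P.Assumptions) (ha : a ∈ P.Ω)
    (hgap : ∀ j, a j ≠ 0 → P.ν ≤ |a j|)
    (hmin : ∀ z ∈ P.Ω, (∀ j, a j = 0 → z j = 0) → P.f a ≤ P.f z) : P.IsSwdStationary a := by
  have hν := hP.ν_pos
  refine ⟨ha, ?_⟩
  obtain ⟨ζ, hζ, hζmin⟩ := hP.exists_mem_subdiff_f ha hmin
  rintro v ⟨c, hc, d, ⟨d', hd', rfl⟩, rfl⟩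
  rw [mem_singleton_iff] at hc
  obtain ⟨g, hg, rfl⟩ := (Set.mem_finsetSum _ _ _).1 hd'
  have hg' : ∀ l, ∃ η ∈ subdiff (fun z : E n =>
      theta (P.idxJ a l).castSucc (groupNorm P.p (P.G l) z) P.ν) a, P.w l • η = g l :=
    fun l => hg (Finset.mem_univ l)
  choose η hη hηg using hg'
  subst hc
  -- The splitting `v = (v + ζ') + (-ζ')` uses the optimal subgradient truncated to the support of
  -- `a`. The discarded entries are at most `L_f < λ₁/ν` in absolute value and are absorbed by the
  -- kink of `(λ₁/ν) |·|` at zero.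
  let ζ' : E n := WithLp.toLp 2 fun j => if a j = 0 then 0 else ζ j
  have hζ' : ∀ j, ζ' j = if a j = 0 then 0 else ζ j := fun j => rfl
  refine ⟨_ + ζ', ?_, -ζ', ?_, add_neg_cancel_right _ _⟩
  · intro z
    have hlam : P.lam1 * ∑ j, (theta (P.idxI a j) (z j) P.ν - theta (P.idxI a j) (a j) P.ν)
        + ⟪ζ', z - a⟫_ℝ ≤ ⟪ζ, z - a⟫_ℝ + P.lam1 / P.ν * ∑ j, (|z j| - |a j|) := by
      rw [inner_eq_sum, inner_eq_sum, Finset.mul_sum, Finset.mul_sum, ← Finset.sum_add_distrib,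
        ← Finset.sum_add_distrib]
      refine Finset.sum_le_sum fun j _ => ?_
      rw [hζ']
      by_cases hj : a j = 0
      · rw [idxI_eq_zero hν (by simpa [hj] using hν)]
        have h1 : |ζ j| ≤ P.lam1 / P.ν := (hP.Lf_bound a ha ζ hζ j).trans
          ((le_div_iff₀ hν).2 (by linarith [hP.ν_lt, mul_comm P.ν P.Lf]))
        have h2 := mul_le_mul_of_nonneg_right h1 (abs_nonneg (z j))
        rw [← abs_mul] at h2
        have h3 := neg_abs_le (ζ j * z j)
        simp [hj]
        linarith
      · rw [if_neg hj]
        have hl : 0 ≤ P.lam1 / P.ν := (div_pos hP.lam1_pos hν).le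
        rcases le_abs'.1 (hgap j hj) with hs | hs
        · rw [idxI_eq_two hν hs, theta_two, theta_two, abs_of_neg (show a j < 0 by linarith)]
          have h1 := mul_le_mul_of_nonneg_left (neg_abs_le (z j)) hl
          have h2 : P.lam1 * (-z j / P.ν - 1 - (-a j / P.ν - 1))
            = P.lam1 / P.ν * (-z j) + P.lam1 / P.ν * a j := by ring
          rw [h2]
          linarith
        · rw [idxI_eq_one hν hs, theta_one, theta_one, abs_of_pos (show 0 < a j by linarith)]
          have h1 := mul_le_mul_of_nonneg_left (le_abs_self (z j)) hl
          have h2 : P.lam1 * (z j / P.ν - 1 - (a j / P.ν - 1))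
            = P.lam1 / P.ν * z j - P.lam1 / P.ν * a j := by ring
          rw [h2]
          linarith
    have hgr : ∑ l, ⟪g l, z - a⟫_ℝ
        ≤ (∑ l, (P.w l * groupNorm P.p (P.G l) z - P.w l * groupNorm P.p (P.G l) a)) / P.ν := by
      rw [Finset.sum_div]
      refine Finset.sum_le_sum fun l _ => ?_
      rw [← hηg, real_inner_smul_left, ← mul_sub, mul_div_assoc]
      refine mul_le_mul_of_nonneg_left ?_ (hP.w_nonneg l)
      have h1 := hη l z
      rcases lt_or_ge (groupNorm P.p (P.G l) a) P.ν with hl | hl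
      · rw [idxJ_eq_zero hν hl] at h1
        rw [groupNorm_eq_zero hP.p_eq fun j => hP.eq_zero_of_groupNorm_lt hgap hl, sub_zero]
        simp only [Fin.castSucc_zero, theta_zero, zero_add] at h1
        exact h1.trans (div_nonneg (groupNorm_nonneg hP.p_eq _ _) hν.le)
      · rw [idxJ_eq_one hν hl] at h1
        simp only [show (1 : Fin 2).castSucc = (1 : Fin 3) from rfl, theta_one] at h1
        rw [sub_div]
        linarith
    have hgr' := mul_le_mul_of_nonneg_left hgr hP.lam2_nonneg
    have hf := hζ z
    have h1 : ∀ j, ⟪∇ (fun z : E n => theta (P.idxI a j) (z j) P.ν) a, z - a⟫_ℝ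
        = theta (P.idxI a j) (z j) P.ν - theta (P.idxI a j) (a j) P.ν := fun j => by
      rw [inner_gradient_theta, PiLp.sub_apply, add_sub_cancel]
    rw [inner_add_left, inner_add_left, real_inner_smul_left, sum_inner]
    simp only [real_inner_smul_left, sum_inner, h1]
    rw [Finset.sum_sub_distrib] at hgr' hlam
    rw [Finset.sum_sub_distrib, mul_sub] at hlam
    rw [mul_div_assoc', mul_sub, sub_div] at hgr'
    rw [Finset.sum_sub_distrib, fbar, fbar, div_mul_eq_mul_div P.lam2, div_mul_eq_mul_div P.lam2]
    linarith
  · intro z hz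
    -- Setting entries to zero stays in the box and is not seen by `ζ'`, so optimality of `ζ` on the
    -- restricted set gives the normal cone inequality on all of `Ω`.
    let z' : E n := WithLp.toLp 2 fun j => if a j = 0 then 0 else z j
    have hz' : z' ∈ P.Ω := hP.mem_Ω_of_eq_mul hz fun j => by
      by_cases hj : a j = 0
      · exact ⟨0, ⟨le_rfl, zero_le_one⟩, by simp [z', hj]⟩
      · exact ⟨1, ⟨zero_le_one, le_rfl⟩, by simp [z', hj]⟩
    have h1 := hζmin z' hz' fun j hj => by simp [z', hj]
    have h2 : ⟪ζ', z - a⟫_ℝ = ⟪ζ, z' - a⟫_ℝ := by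
      rw [inner_eq_sum, inner_eq_sum]
      refine Finset.sum_congr rfl fun j _ => ?_
      by_cases hj : a j = 0 <;> simp [ζ', z', hj]
    rw [inner_neg_left, h2]
    linarith

end Stationary

end Problem

/-- A sequence of squares that is dominated by the decrements of a sequence bounded below tends to
zero. -/
theorem tendsto_zero_of_sq_le_sub {H d : ℕ → ℝ} {c m : ℝ} (hc : 0 < c) (hm : ∀ k, m ≤ H k)
    (hH : ∀ k, c * d k ^ 2 ≤ H k - H (k + 1)) : Tendsto d atTop (𝓝 0) := by
  have hanti : Antitone H := antitone_nat_of_succ_le fun k => by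
    have : 0 ≤ c * d k ^ 2 := by positivity
    linarith [hH k]
  have hlim := tendsto_atTop_ciInf hanti ⟨m, by rintro _ ⟨k, rfl⟩; exact hm k⟩
  have h1 : Tendsto (fun k => (H k - H (k + 1)) / c) atTop (𝓝 0) := by
    have := (hlim.sub (hlim.comp (tendsto_add_atTop_nat 1))).div_const c
    simpa using this
  have h2 : Tendsto (fun k => d k ^ 2) atTop (𝓝 0) := by
    refine squeeze_zero (fun k => sq_nonneg _) (fun k => ?_) h1
    rw [le_div_iff₀ hc]
    linarith [hH k]
  have h3 := h2.sqrt
  simp only [Real.sqrt_sq_eq_abs, Real.sqrt_zero] at h3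
  exact (tendsto_zero_iff_abs_tendsto_zero _).2 h3

theorem eventually_and_mem_of_mapClusterPt {α : Type*} [TopologicalSpace α] {u : ℕ → α} {a : α}
    {s : Set α} (hs : IsClosed s) (ha : MapClusterPt a atTop u) (h : ∀ᶠ k in atTop, u k ∈ s) :
    ∀ᶠ k in atTop, u k ∈ s ∧ a ∈ s := by
  have has := hs.mem_of_mapClusterPt ha h
  filter_upwards [h] with k hk using ⟨hk, has⟩

/-! ### Patterns of zeros and signs. -/

namespace Problem

variable {n L : ℕ} {P : Problem n L}

/-- Two points have the same pattern: each entry is zero for both, or at least `ν` for both, or at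
most `-ν` for both. -/
def SamePattern (P : Problem n L) (x y : E n) : Prop :=
  ∀ j, (x j = 0 ∧ y j = 0) ∨ (P.ν ≤ x j ∧ P.ν ≤ y j) ∨ (x j ≤ -P.ν ∧ y j ≤ -P.ν)

theorem SamePattern.idxI_eq {x y : E n} (h : P.SamePattern x y) (hν : 0 < P.ν) :
    P.idxI x = P.idxI y := by
  funext j
  rcases h j with ⟨h1, h2⟩ | ⟨h1, h2⟩ | ⟨h1, h2⟩
  · rw [idxI_eq_zero hν (by simpa [h1]), idxI_eq_zero hν (by simpa [h2])]
  · rw [idxI_eq_one hν h1, idxI_eq_one hν h2]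
  · rw [idxI_eq_two hν h1, idxI_eq_two hν h2]

theorem SamePattern.le_abs {x y : E n} (h : P.SamePattern x y) {j : Fin n} (hj : y j ≠ 0) :
    P.ν ≤ |y j| := by
  rcases h j with ⟨_, h2⟩ | ⟨_, h2⟩ | ⟨_, h2⟩
  · exact absurd h2 hj
  · exact h2.trans (le_abs_self _)
  · exact le_abs'.2 (Or.inl h2)

theorem SamePattern.symm {x y : E n} (h : P.SamePattern x y) : P.SamePattern y x := fun j =>
  (h j).imp And.symm (Or.imp And.symm And.symm)

theorem SamePattern.eq_zero {x y : E n} (h : P.SamePattern x y) (hν : 0 < P.ν) {j : Fin n}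
    (hj : y j = 0) : x j = 0 := by
  rcases h j with ⟨h1, _⟩ | ⟨_, h2⟩ | ⟨_, h2⟩
  · exact h1
  · linarith
  · linarith

/-- A group is either zero at both points or contains an entry of absolute value at least `ν` at
both, which lifts both group norms to at least `ν`. -/
theorem SamePattern.idxJ_eq {x y : E n} (h : P.SamePattern x y) (hP : P.Assumptions) :
    P.idxJ x = P.idxJ y := by
  have hν := hP.ν_pos
  funext l
  by_cases hl : ∀ j ∈ P.G l, x j = 0
  · rw [idxJ_eq_zero hν (by rwa [groupNorm_eq_zero hP.p_eq hl]), idxJ_eq_zero hν]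
    rwa [groupNorm_eq_zero hP.p_eq fun j hj => h.symm.eq_zero hν (hl j hj)]
  · push Not at hl
    obtain ⟨j, hj, hxj⟩ := hl
    rw [idxJ_eq_one hν ((h.symm.le_abs hxj).trans (abs_le_groupNorm hP.p_eq hj x)),
      idxJ_eq_one hν ((h.le_abs fun h0 => hxj (h.eq_zero hν h0)).trans
        (abs_le_groupNorm hP.p_eq hj y))]

/-! ### Asymptotics of the iterates. -/

section Run

variable {μ : ℕ → ℝ} {β : ℝ} {b : ℕ → ℝ} {xprev : E n} {ξ x : ℕ → E n}

theorem IsRun.mem_Ω (hx : P.IsRun μ β b xprev ξ x) : ∀ k, x k ∈ P.Ω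
  | 0 => hx.init
  | k + 1 => hx.mem k

theorem IsRun.exists_isStep (hx : P.IsRun μ β b xprev ξ x) :
    ∃ K, ∀ k ≥ K, P.IsStep (x k) (extrap xprev x b k) (ξ k) (x (k + 1)) := by
  obtain ⟨K, μbar, -, -, -, hμ⟩ := hx.schedule
  refine ⟨K, fun k hk => ?_⟩
  have hk' : μ k = P.ν := by rw [hμ, if_neg (not_lt.2 hk)]
  have h1 := hx.subgrad k
  have h2 := hx.argmin k
  rw [hk'] at h1 h2
  exact ⟨hx.mem_Ω k, hx.mem k, h1, h2⟩

/-- The distance of successive iterates tends to zero. -/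
theorem IsRun.tendsto_norm_sub (hx : P.IsRun μ β b xprev ξ x) (hP : P.Assumptions) :
    Tendsto (fun k => ‖x (k + 1) - x k‖) atTop (𝓝 0) := by
  obtain ⟨K, hK⟩ := hx.exists_isStep
  obtain ⟨m, hm⟩ := hP.exists_le_f hx.init
  have hLs := hP.Ls_pos
  obtain ⟨hβ0, hβ1⟩ := hx.β_mem
  rw [← tendsto_add_atTop_iff_nat K]
  -- The extrapolation returns at most the fraction `β²` of the previous squared step, which leaves
  -- the factor `1 - β²`. The index starts at `K + 1`, so the predecessor is a genuine iterate and
  -- not `xprev`.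
  refine tendsto_zero_of_sq_le_sub (c := P.Ls / 2 * (1 - β ^ 2)) (m := m)
    (H := fun k => P.capped (x (k + K + 1)) + P.Ls / 2 * ‖x (k + K + 1) - x (k + K)‖ ^ 2)
    (mul_pos (by linarith) (by nlinarith)) (fun k => ?_) fun k => ?_
  · have h1 := hm _ (hx.mem_Ω (k + K + 1))
    have h2 := hP.f_le_capped (x (k + K + 1))
    have : 0 ≤ P.Ls / 2 * ‖x (k + K + 1) - x (k + K)‖ ^ 2 := by positivity
    linarith
  · have h1 := (hK (k + K + 1) (by omega)).capped_add_le hP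
    have h2 : ‖x (k + K + 1) - extrap xprev x b (k + K + 1)‖
        = b (k + K + 1) * ‖x (k + K + 1) - x (k + K)‖ := by
      rw [extrap, sub_add_cancel_left, norm_neg, norm_smul,
        Real.norm_of_nonneg (hx.b_mem _).1]
      rfl
    have h3 : b (k + K + 1) ^ 2 ≤ β ^ 2 := pow_le_pow_left₀ (hx.b_mem _).1 (hx.b_mem _).2 2
    rw [h2, mul_pow] at h1
    have h4 : P.Ls / 2 * (b (k + K + 1) ^ 2 * ‖x (k + K + 1) - x (k + K)‖ ^ 2)
        ≤ P.Ls / 2 * (β ^ 2 * ‖x (k + K + 1) - x (k + K)‖ ^ 2) := by gcongr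
    rw [show k + 1 + K = k + K + 1 by omega]
    linarith

theorem IsRun.tendsto_extrap_sub (hx : P.IsRun μ β b xprev ξ x) (hP : P.Assumptions) :
    Tendsto (fun k => ‖extrap xprev x b k - x k‖) atTop (𝓝 0) := by
  rw [← tendsto_add_atTop_iff_nat 1]
  refine squeeze_zero (fun k => norm_nonneg _) (fun k => ?_) (hx.tendsto_norm_sub hP)
  rw [extrap, add_sub_cancel_left, norm_smul, Real.norm_of_nonneg (hx.b_mem _).1]
  exact mul_le_of_le_one_left (norm_nonneg _) ((hx.b_mem _).2.trans hx.β_mem.2.le)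

theorem IsRun.tendsto_sub_extrap (hx : P.IsRun μ β b xprev ξ x) (hP : P.Assumptions) :
    Tendsto (fun k => ‖x (k + 1) - extrap xprev x b k‖) atTop (𝓝 0) := by
  have := (hx.tendsto_norm_sub hP).add (hx.tendsto_extrap_sub hP)
  rw [add_zero] at this
  refine squeeze_zero (fun k => norm_nonneg _) (fun k => ?_) this
  rw [norm_sub_rev (extrap xprev x b k)]
  exact norm_sub_le_norm_sub_add_norm_sub _ _ _

/-- The error terms in `IsStep.apply_eq_zero` tend to zero, whereas `λ₁/ν - L_f` is a fixed positive
margin. -/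
theorem IsRun.eventually_apply_eq_zero (hx : P.IsRun μ β b xprev ξ x) (hP : P.Assumptions) :
    ∀ᶠ k in atTop, ∀ j, |x k j| < P.ν → x (k + 1) j = 0 := by
  obtain ⟨K, hK⟩ := hx.exists_isStep
  have hpos : 0 < P.lam1 / P.ν - P.Lf :=
    sub_pos.2 ((lt_div_iff₀ hP.ν_pos).2 (by linarith [hP.ν_lt, mul_comm P.ν P.Lf]))
  have hlim := (((hx.tendsto_extrap_sub hP).const_mul P.Ls).add
    ((hx.tendsto_sub_extrap hP).const_mul P.Ls)).add
    (((((hx.tendsto_norm_sub hP).const_mul 2).div_const P.ν).div_const P.ν).const_mul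
      (P.lam2 * ∑ l, P.w l))
  simp only [mul_zero, zero_div, add_zero] at hlim
  filter_upwards [hlim.eventually (gt_mem_nhds hpos), eventually_ge_atTop K] with k hk hkK j hj
  exact (hK k hkK).apply_eq_zero hP hj hk

/-- Late in the run, an entry below `ν` in absolute value becomes zero and, being again below `ν`,
remains zero. An entry that never gets there would need a jump of at least `2ν` to change sign, but
steps are shorter than `ν`. -/
theorem IsRun.eventually_pattern (hx : P.IsRun μ β b xprev ξ x) (hP : P.Assumptions) (j : Fin n) :
    (∀ᶠ k in atTop, x k j = 0) ∨ (∀ᶠ k in atTop, P.ν ≤ x k j) ∨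
      (∀ᶠ k in atTop, x k j ≤ -P.ν) := by
  have hν := hP.ν_pos
  obtain ⟨K, hK⟩ := eventually_atTop.1 ((hx.eventually_apply_eq_zero hP).and
    ((hx.tendsto_norm_sub hP).eventually (gt_mem_nhds hν)))
  by_cases h : ∃ k ≥ K, |x k j| < P.ν
  · obtain ⟨k, hk, hkj⟩ := h
    left
    refine eventually_atTop.2 ⟨k + 1, fun m hm => ?_⟩
    induction m, hm using Nat.le_induction with
    | base => exact (hK k hk).1 j hkj
    | succ m hm ih => exact (hK m (by omega)).1 j (by simpa [ih])
  · push Not at h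
    have hstep : ∀ k ≥ K, |x (k + 1) j - x k j| < P.ν := fun k hk =>
      (PiLp.norm_apply_le (x (k + 1) - x k) j).trans_lt (hK k hk).2
    right
    rcases le_abs'.1 (h K le_rfl) with hs | hs
    · right
      refine eventually_atTop.2 ⟨K, fun m hm => ?_⟩
      induction m, hm using Nat.le_induction with
      | base => exact hs
      | succ m hm ih =>
        rcases le_abs'.1 (h (m + 1) (by omega)) with h1 | h1
        · exact h1
        · have := (abs_lt.1 (hstep m hm)).2
          linarith
    · left
      refine eventually_atTop.2 ⟨K, fun m hm => ?_⟩
      induction m, hm using Nat.le_induction with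
      | base => exact hs
      | succ m hm ih =>
        rcases le_abs'.1 (h (m + 1) (by omega)) with h1 | h1
        · have := (abs_lt.1 (hstep m hm)).1
          linarith
        · exact h1

theorem IsRun.eventually_samePattern_succ (hx : P.IsRun μ β b xprev ξ x) (hP : P.Assumptions) :
    ∀ᶠ k in atTop, P.SamePattern (x (k + 1)) (x k) := by
  refine eventually_all.2 fun j => ?_
  have hs := tendsto_add_atTop_nat 1
  rcases hx.eventually_pattern hP j with h | h | h
  · filter_upwards [h, hs.eventually h] with k h1 h2 using Or.inl ⟨h2, h1⟩
  · filter_upwards [h, hs.eventually h] with k h1 h2 using Or.inr (Or.inl ⟨h2, h1⟩)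
  · filter_upwards [h, hs.eventually h] with k h1 h2 using Or.inr (Or.inr ⟨h2, h1⟩)

theorem IsRun.eventually_samePattern (hx : P.IsRun μ β b xprev ξ x) (hP : P.Assumptions)
    {a : E n} (ha : MapClusterPt a atTop x) : ∀ᶠ k in atTop, P.SamePattern (x k) a := by
  refine eventually_all.2 fun j => ?_
  have hc : Continuous fun z : E n => z j := PiLp.continuous_apply 2 _ j
  rcases hx.eventually_pattern hP j with h | h | h
  · filter_upwards [eventually_and_mem_of_mapClusterPt
      (isClosed_eq hc continuous_const) ha h] with k hk using Or.inl hk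
  · filter_upwards [eventually_and_mem_of_mapClusterPt
      (isClosed_le continuous_const hc) ha h] with k hk using Or.inr (Or.inl hk)
  · filter_upwards [eventually_and_mem_of_mapClusterPt
      (isClosed_le hc continuous_const) ha h] with k hk using Or.inr (Or.inr hk)

/-- Accumulation points are fixed points of the DC step. -/
theorem IsRun.fnbar_le_of_mapClusterPt (hx : P.IsRun μ β b xprev ξ x) (hP : P.Assumptions)
    {a : E n} (ha : MapClusterPt a atTop x) {z : E n} (hz : z ∈ P.Ω) :
    P.fnbar a P.ν ≤ P.fnbar z P.ν + ⟪∇ P.fs a, z - a⟫_ℝ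
      + (P.Theta (P.idxI a) (P.idxJ a) (a + a - z) P.ν
        - P.Theta (P.idxI a) (P.idxJ a) a P.ν) := by
  obtain ⟨K, hK⟩ := hx.exists_isStep
  obtain ⟨φ, hφ, hlim⟩ := ha.tendsto_subseq
  have hφ' := hφ.tendsto_atTop
  have hlim1 : Tendsto (fun k => x (φ k + 1)) atTop (𝓝 a) := by
    have := hlim.add (tendsto_zero_iff_norm_tendsto_zero.2 ((hx.tendsto_norm_sub hP).comp hφ'))
    simpa using this
  have hlimy : Tendsto (fun k => extrap xprev x b (φ k)) atTop (𝓝 a) := by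
    have := hlim.add (tendsto_zero_iff_norm_tendsto_zero.2 ((hx.tendsto_extrap_sub hP).comp hφ'))
    simpa using this
  have hΘ := hP.continuous_Theta (P.idxI a) (P.idxJ a) P.ν
  have hl := ((hP.continuous_fnbar hP.ν_pos).tendsto a).comp hlim1
  have hr := (((tendsto_const_nhds (x := P.fnbar z P.ν)).add
    (((hP.continuous_gradient_fs.tendsto a).comp hlimy).inner
      ((tendsto_const_nhds (x := z)).sub hlim1))).add
    (((hΘ.tendsto _).comp ((hlim.add hlim1).sub (tendsto_const_nhds (x := z)))).sub
      ((hΘ.tendsto _).comp hlim))).add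
    (((hlim1.sub hlimy).inner ((tendsto_const_nhds (x := z)).sub hlim1)).const_mul P.Ls)
  rw [sub_self, inner_zero_left, mul_zero, add_zero] at hr
  refine le_of_tendsto_of_tendsto hl hr ?_
  filter_upwards [hφ'.eventually (eventually_ge_atTop K),
    hφ'.eventually (hx.eventually_samePattern hP ha)] with k hk hpat
  have h1 := (hK _ hk).fnbar_le hP hz
  -- At this point the displacement from `x (φ k)` is exactly `-(z - x (φ k + 1))`, so `ξ` cancels
  -- against the step inequality and no convergence of the subgradients is needed.
  have h2 := (hK _ hk).subgrad (x (φ k) + x (φ k + 1) - z)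
  rw [hpat.idxI_eq hP.ν_pos, hpat.idxJ_eq hP,
    show x (φ k) + x (φ k + 1) - z - x (φ k) = -(z - x (φ k + 1)) by abel, inner_neg_right] at h2
  simp only [Function.comp_apply]
  linarith

end Run

end Problem

end SparseGroup

theorem theorem3p2 {n L : ℕ} (P : SparseGroup.Problem n L) (hP : P.Assumptions)
    (μ : ℕ → ℝ) (β : ℝ) (b : ℕ → ℝ) (xprev : SparseGroup.E n)
    (ξ x : ℕ → SparseGroup.E n) (hx : P.IsRun μ β b xprev ξ x) :
    {k | P.idxI (x (k + 1)) ≠ P.idxI (x k)}.Finite ∧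
    {k | P.idxJ (x (k + 1)) ≠ P.idxJ (x k)}.Finite ∧
    (∀ a c : SparseGroup.E n, MapClusterPt a atTop x → MapClusterPt c atTop x →
      SparseGroup.zeroSet a = SparseGroup.zeroSet c) ∧
    (∀ a : SparseGroup.E n, MapClusterPt a atTop x →
      ∃ k₀, ∀ k ≥ k₀, ∀ j ∈ SparseGroup.zeroSet a, x k j = 0) ∧
    (∀ a : SparseGroup.E n, MapClusterPt a atTop x →
      P.IsSwdStationary a ∧ P.IsStrongLocalMin a) := by
  have hν := hP.ν_pos
  refine ⟨?_, ?_, fun a c ha hc => ?_, fun a ha => ?_, fun a ha => ?_⟩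
  · have h : ∀ᶠ k in atTop, P.idxI (x (k + 1)) = P.idxI (x k) :=
      (hx.eventually_samePattern_succ hP).mono fun k hk => hk.idxI_eq hν
    rwa [← Nat.cofinite_eq_atTop, eventually_cofinite] at h
  · have h : ∀ᶠ k in atTop, P.idxJ (x (k + 1)) = P.idxJ (x k) :=
      (hx.eventually_samePattern_succ hP).mono fun k hk => hk.idxJ_eq hP
    rwa [← Nat.cofinite_eq_atTop, eventually_cofinite] at h
  · obtain ⟨k, hka, hkc⟩ :=
      ((hx.eventually_samePattern hP ha).and (hx.eventually_samePattern hP hc)).exists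
    ext j
    exact ⟨fun h => hkc.symm.eq_zero hν (hka.eq_zero hν h),
      fun h => hka.symm.eq_zero hν (hkc.eq_zero hν h)⟩
  · obtain ⟨k₀, hk₀⟩ := eventually_atTop.1 (hx.eventually_samePattern hP ha)
    exact ⟨k₀, fun k hk j hj => (hk₀ k hk).eq_zero hν hj⟩
  · have haΩ : a ∈ P.Ω := SparseGroup.Problem.isClosed_Ω.mem_of_mapClusterPt ha
      (.of_forall hx.mem_Ω)
    obtain ⟨k, hk⟩ := (hx.eventually_samePattern hP ha).exists
    have hgap : ∀ j, a j ≠ 0 → P.ν ≤ |a j| := fun j hj => hk.le_abs hj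
    have hmin : ∀ z ∈ P.Ω, (∀ j, a j = 0 → z j = 0) → P.f a ≤ P.f z := fun z hz hza =>
      hP.f_le_of_fnbar_le haΩ hgap (fun z hz => hx.fnbar_le_of_mapClusterPt hP ha hz) hz hza
    exact ⟨hP.isSwdStationary haΩ hgap hmin, hP.isStrongLocalMin haΩ hgap hmin⟩
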